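/- Let $0<\alpha_1<1$, $\alpha_1+\alpha_2=1$, $\sigma_1,\sigma_2>0$ with $\sigma_1^2\neq\sigma_2^2$, let $c>0$, and let $G=\alpha_1\delta_{\sigma_1^2}+\alpha_2\delta_{\sigma_2^2}$. Let $F^{c,G}$ be the limiting spectral distribution with dimensional ratio $c$ and mixing distribution $G$ (spherical case), that is, the probability measure on $\mathbb R$ whose Stieltjes transform $m(z)=\int\frac{1}{x-z}\,dF^{c,G}(x)$ satisfies $$z=-\frac1{m(z)}+\int\frac{t}{1+ct\,m(z)}\,dG(t)\qquad\text{for all } z\in\mathbb C,\ \operatorname{Im} z>0 .$$ Let $S_F$ be its support. Put $$u(x)=-\frac1x+\int\frac{t}{1+ctx}\,dG(t),\qquad f(x)=c-\int\Big(\frac{ctx}{1+ctx}\Big)^2dG(t),$$ for real $x\ne0$ with $1+c\sigma_i^2x\neq0$ $(i=1,2)$, and let $Z$ be the set of zeros of $f$ among these $x$. Then the equation $\int\frac{t^2}{(1+tx)^3}\,dG(t)=0$ (over real $x$ with $1+\sigma_i^2x\ne0$, $i=1,2$) has exactly one real root $x^*$, and with $$c_0=\int\frac{(tx^*)^2}{(1+tx^*)^2}\,dG(t)$$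 the following holds. (i) If $c>c_0$, there are real numbers $0\le s_1<s_2<s_3<s_4$, depending only on $c$ and $G$, such that $$S_F\setminus\{0\}=\big([s_1,s_2]\cup[s_3,s_4]\big)\setminus\{0\}.$$ Here $u(Z)=\{s_1,s_2,s_3,s_4\}$ if $c\neq1$, and $u(Z)=\{s_2,s_3,s_4\}$ if $c=1$. (ii) If $c\le c_0$, there are real numbers $0\le s_1<s_4$, depending only on $c$ and $G$, such that $$S_F\setminus\{0\}=[s_1,s_4]\setminus\{0\}.$$ Here $u(Z\setminus\{x^*/c\})=\{s_1,s_4\}$ if $c\ne1$, and $u(Z\setminus\{x^*/c\})=\{s_4\}$ if $c=1$. In both cases $s_1=0$ if and only if $c=1$; in particular, for $c\neq1$ the set $S_F\setminus\{0\}$ equals $[s_1,s_2]\cup[s_3,s_4]$, respectively $[s_1,s_4]$. -/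

import Mathlib

open MeasureTheory

noncomputable section

namespace ScaleMixture

/-- The Stieltjes transform `m_P(z) = ∫ 1 / (x - z) dP(x)`. -/
def stieltjes (P : Measure ℝ) (z : ℂ) : ℂ :=
  ∫ x : ℝ, 1 / ((x : ℂ) - z) ∂P

/-- `F` is the limiting spectral distribution with dimensional ratio `c`, mixing distribution `G`
and spherical population: the probability measure on `ℝ` whose Stieltjes transform `m` satisfies
`z = -1 / m + ∫ t / (1 + c t m) dG(t)` on the upper half-plane. (For such `z` one has `Im m > 0`,
so for real `t` no denominator vanishes.) -/
structure IsLSD (c : ℝ) (G F : Measure ℝ) : Prop where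
  isProbabilityMeasure : IsProbabilityMeasure F
  equation : ∀ z : ℂ, 0 < z.im →
    z = -1 / stieltjes F z +
      ∫ t : ℝ, (t : ℂ) / (1 + (c : ℂ) * (t : ℂ) * stieltjes F z) ∂G

/-- The two-point distribution `α₁ δ_{v₁} + α₂ δ_{v₂}`. -/
def twoAtom (α₁ α₂ v₁ v₂ : ℝ) : Measure ℝ :=
  ENNReal.ofReal α₁ • Measure.dirac v₁ + ENNReal.ofReal α₂ • Measure.dirac v₂

/-- `x` is a real root of `∫ t² / (1 + t x)³ dG(t) = 0` (with no vanishing denominator). -/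
def IsCriticalRoot (G : Measure ℝ) (x : ℝ) : Prop :=
  (∀ t ∈ G.support, 1 + t * x ≠ 0) ∧ ∫ t, t ^ 2 / (1 + t * x) ^ 3 ∂G = 0

/-- The value `∫ (t x)² / (1 + t x)² dG(t)`. -/
def criticalRatio (G : Measure ℝ) (x : ℝ) : ℝ :=
  ∫ t, (t * x) ^ 2 / (1 + t * x) ^ 2 ∂G

/-- The real function `u(x) = -1 / x + ∫ t / (1 + c t x) dG(t)`. -/
def u (c : ℝ) (G : Measure ℝ) (x : ℝ) : ℝ :=
  -1 / x + ∫ t, t / (1 + c * t * x) ∂G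

/-- The domain of `u`. -/
def uDomain (c : ℝ) (G : Measure ℝ) : Set ℝ :=
  {x | x ≠ 0 ∧ ∀ t ∈ G.support, 1 + c * t * x ≠ 0}

/-- The zeros, in the domain of `u`, of
`f(x) = c - ∫ (c t x / (1 + c t x))² dG(t) = c x² u'(x)`. -/
def criticalPoints (c : ℝ) (G : Measure ℝ) : Set ℝ :=
  {x ∈ uDomain c G | c - ∫ t, (c * t * x / (1 + c * t * x)) ^ 2 ∂G = 0}

end ScaleMixture

end

/-!
Write `m` for the Stieltjes transform of `F`, so that `u (m z) = z` on the upper half-plane. Taking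
imaginary parts there gives `c Im z = (Im m / |m|²) (c - E(m))` with
`E(m) = ∫ |c t m / (1 + c t m)|² dG(t)`, hence `E(m z) < c`. This controls `u` in both directions,
through the identity `c (u m - u n) = (1/n - 1/m) (c - ∫ w_m w_n dG)`, `w_m = c t m / (1 + c t m)`.

* If `u' > 0` at a real point `x`, that is `E(x) < c`, the identity and AM-GM force `m z → x` as
  `z → u x`. Then `Im m = O(Im z)` near `u x`, and `F` has no mass there.
* If `s` lies in a gap of the support of `F`, then `m` extends to real values near `s`. The bound on
  `E` makes the `G`-mass of the ball of radius `η` about `-1 / (c m(x))` of order `η²` for all `x`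
  near `s`, so `m s` lies in the domain of `u`; in the limit `u (m s) = s` and `E(m s) < c`.

So the complement of the support is the image under `u` of the set where `u' > 0`. For two atoms
this set is described in the coordinate `r = 1 / (c x)`: there `E` is the sum of two squared simple
fractions in `r`, monotone to the left and to the right of both poles, with a single minimum between
them at the reciprocal of the critical root. Comparing this minimum with `c` gives two or four
edges, and since `u` decreases in `r` on all of `{E ≤ c}`, their images occur in the opposite order.
-/

namespace ScaleMixture

open Filter Topology Set Metric Asymptotics
open UpperHalfPlane (upperHalfPlaneSet)

section Measure

variable {P : Measure ℝ} [IsFiniteMeasure P]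

theorem image_mem_nhds_of_injOn {f : ℝ → ℝ} {s : Set ℝ} {x : ℝ} (hs : s ∈ 𝓝 x)
    (hcont : ContinuousOn f s) (hinj : InjOn f s) : f '' s ∈ 𝓝 (f x) := by
  obtain ⟨ε, hε, hball⟩ := Metric.nhds_basis_closedBall.mem_iff.1 hs
  rw [Real.closedBall_eq_Icc] at hball
  have hle : x - ε ≤ x + ε := by linarith
  have hcont' := hcont.mono hball
  have hleft := left_mem_Icc.2 hle
  have hright := right_mem_Icc.2 hle
  have hx : x ∈ Icc (x - ε) (x + ε) := ⟨by linarith, by linarith⟩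
  rcases hcont'.strictMonoOn_of_injOn_Icc' hle (hinj.mono hball) with hmono | hanti
  · exact mem_of_superset
      (Icc_mem_nhds (hmono hleft hx (by linarith)) (hmono hx hright (by linarith)))
      ((intermediate_value_Icc hle hcont').trans (image_mono hball))
  · exact mem_of_superset
      (Icc_mem_nhds (hanti hx hright (by linarith)) (hanti hleft hx (by linarith)))
      ((intermediate_value_Icc' hle hcont').trans (image_mono hball))

theorem abs_measureReal_Iic_sub_le (x y : ℝ) :
    |P.real (Iic y) - P.real (Iic x)| ≤ P.real (closedBall x |y - x|) := by
  refine (abs_measureReal_sub_le_measureReal_symmDiff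
    measurableSet_Iic.nullMeasurableSet measurableSet_Iic.nullMeasurableSet).trans
    (measureReal_mono fun t ht => ?_)
  simp only [Set.mem_symmDiff, mem_Iic] at ht
  rw [mem_closedBall, Real.dist_eq]
  grind

theorem hasDerivAt_measureReal_Iic_zero {x : ℝ}
    (h : (fun η => P.real (closedBall x η)) =O[𝓝[>] 0] fun η => η ^ 2) :
    HasDerivAt (fun y => P.real (Iic y)) 0 x := by
  have hdist : Tendsto (fun y => |y - x|) (𝓝[≠] x) (𝓝[>] 0) :=
    tendsto_nhdsWithin_iff.2
      ⟨(Continuous.tendsto' (by fun_prop) x 0 (by simp)).mono_left nhdsWithin_le_nhds,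
        eventually_nhdsWithin_of_forall fun y hy => abs_pos.2 (sub_ne_zero.2 hy)⟩
  have hquadratic : (fun y => P.real (Iic y) - P.real (Iic x)) =O[𝓝[≠] x] fun y => (y - x) ^ 2 :=
    (IsBigO.of_norm_le fun y => abs_measureReal_Iic_sub_le x y).trans
      (by simpa only [Function.comp_def, sq_abs] using h.comp_tendsto hdist)
  have hlittle : (fun y => (y - x) ^ 2) =o[𝓝[≠] x] fun y => y - x :=
    (isLittleO_pow_sub_sub x one_lt_two).mono nhdsWithin_le_nhds |>.congr_left (by simp)
  rw [hasDerivAt_iff_isLittleO, ← nhdsWithin_univ, ← union_compl_self {x}, ← insert_eq,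
    isLittleO_insert (by simp)]
  simpa only [smul_zero, sub_zero] using hquadratic.trans_isLittleO hlittle

theorem notMem_support_of_isBigO {s : ℝ}
    (h : ∀ᶠ x in 𝓝 s, (fun η => P.real (closedBall x η)) =O[𝓝[>] 0] fun η => η ^ 2) :
    s ∉ P.support := by
  obtain ⟨ε, hε, hball⟩ := Metric.nhds_basis_closedBall.eventually_iff.1 h
  rw [Real.closedBall_eq_Icc] at hball
  have hconst : P.real (Iic (s + ε)) = P.real (Iic (s - ε)) :=
    constant_of_has_deriv_right_zero
      (fun x hx => (hasDerivAt_measureReal_Iic_zero (hball hx)).continuousAt.continuousWithinAt)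
      (fun x hx =>
        (hasDerivAt_measureReal_Iic_zero (hball (Ico_subset_Icc_self hx))).hasDerivWithinAt)
      _ (right_mem_Icc.2 (by linarith))
  have hzero : P.real (Ioc (s - ε) (s + ε)) = 0 := by
    rw [← Iic_sdiff_Iic, measureReal_sdiff (Iic_subset_Iic.2 (by linarith)) measurableSet_Iic,
      hconst, sub_self]
  exact Measure.notMem_support_iff_exists.2
    ⟨_, Ioc_mem_nhds (by linarith) (by linarith), (measureReal_eq_zero_iff).1 hzero⟩

end Measure

section Integral

variable {Ω E : Type*} [MeasurableSpace Ω] {μ : Measure Ω}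

theorem integral_pos_of_ae_pos {f : Ω → ℝ} (hμ : μ ≠ 0) (hf : Integrable f μ)
    (hpos : ∀ᵐ t ∂μ, 0 < f t) : 0 < ∫ t, f t ∂μ := by
  refine (integral_nonneg_of_ae (hpos.mono fun t => le_of_lt)).lt_of_ne' fun h => ?_
  have hzero := (integral_eq_zero_iff_of_nonneg_ae (hpos.mono fun t => le_of_lt) hf).1 h
  have : NeZero μ := ⟨hμ⟩
  obtain ⟨t, ht, ht'⟩ := (hpos.and hzero).exists
  exact ht.ne' ht'

variable [NormedAddCommGroup E] [NormedSpace ℝ E] [IsFiniteMeasure μ]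

theorem norm_integral_le_integral_min_add {f : Ω → E} (hf : MemLp f 2 μ) {K : ℝ} (hK : 0 < K) :
    ‖∫ t, f t ∂μ‖ ≤ ∫ t, min ‖f t‖ K ∂μ + (∫ t, ‖f t‖ ^ 2 ∂μ) / K := by
  have hnorm := (hf.integrable one_le_two).norm
  have hmin : Integrable (fun t => min ‖f t‖ K) μ := hnorm.inf (integrable_const K)
  have hsq := ((memLp_two_iff_integrable_sq_norm hf.1).1 hf).div_const K
  have hpointwise (t : Ω) : ‖f t‖ ≤ min ‖f t‖ K + ‖f t‖ ^ 2 / K := by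
    rcases le_total ‖f t‖ K with h | h
    · rw [min_eq_left h]
      exact le_add_of_nonneg_right (by positivity)
    · have : ‖f t‖ ≤ ‖f t‖ ^ 2 / K := by rw [le_div_iff₀ hK]; nlinarith [norm_nonneg (f t)]
      rw [min_eq_right h]
      linarith
  calc ‖∫ t, f t ∂μ‖ ≤ ∫ t, ‖f t‖ ∂μ := norm_integral_le_integral_norm _
    _ ≤ ∫ t, (min ‖f t‖ K + ‖f t‖ ^ 2 / K) ∂μ := integral_mono hnorm (hmin.add hsq) hpointwise
    _ = _ := by rw [integral_add hmin hsq, integral_div]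

theorem tendsto_integral_zero_of_memLp_two {ι : Type*} {l : Filter ι} [l.IsCountablyGenerated]
    {w : ι → Ω → E} {C : ℝ} (hw : ∀ᶠ i in l, MemLp (w i) 2 μ)
    (hC : ∀ᶠ i in l, ∫ t, ‖w i t‖ ^ 2 ∂μ ≤ C)
    (hlim : ∀ᵐ t ∂μ, Tendsto (fun i => w i t) l (𝓝 0)) :
    Tendsto (fun i => ∫ t, w i t ∂μ) l (𝓝 0) := by
  have htruncated (K : ℝ) (hK : 0 < K) :
      Tendsto (fun i => ∫ t, min ‖w i t‖ K ∂μ) l (𝓝 0) := by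
    rw [← integral_zero Ω ℝ]
    refine tendsto_integral_filter_of_dominated_convergence (fun _ => K) ?_ ?_
      (integrable_const K) ?_
    · filter_upwards [hw] with i hi using hi.1.norm.inf aestronglyMeasurable_const
    · refine Eventually.of_forall fun i => Eventually.of_forall fun t => ?_
      rw [Real.norm_of_nonneg (by positivity)]
      exact min_le_right _ _
    · filter_upwards [hlim] with t ht
      simpa [hK.le] using ht.norm.min (tendsto_const_nhds (x := K))
  rw [tendsto_zero_iff_norm_tendsto_zero]
  refine tendsto_order.2 ⟨fun b hb => Eventually.of_forall fun i => hb.trans_le (norm_nonneg _),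
    fun ε hε => ?_⟩
  obtain ⟨K, hK, hCK⟩ : ∃ K : ℝ, 0 < K ∧ C / K < ε / 2 :=
    ((eventually_gt_atTop 0).and ((tendsto_const_nhds.div_atTop tendsto_id).eventually_lt_const
      (half_pos hε))).exists
  filter_upwards [hw, hC, (htruncated K hK).eventually_lt_const (half_pos hε)] with i hwi hCi hi
  calc ‖∫ t, w i t ∂μ‖ ≤ ∫ t, min ‖w i t‖ K ∂μ + (∫ t, ‖w i t‖ ^ 2 ∂μ) / K :=
        norm_integral_le_integral_min_add hwi hK
    _ ≤ ∫ t, min ‖w i t‖ K ∂μ + C / K := by gcongr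
    _ < ε := by linarith

end Integral

section Stieltjes

variable {P : Measure ℝ}

/-- The complement in `ℂ` of the support of a measure on the real line. -/
def offSupport (P : Measure ℝ) : Set ℂ :=
  ((↑) '' P.support)ᶜ

theorem mem_offSupport_of_im_pos {z : ℂ} (hz : 0 < z.im) : z ∈ offSupport P := by
  rintro ⟨t, -, rfl⟩
  simp at hz

theorem ofReal_mem_offSupport {x : ℝ} : (x : ℂ) ∈ offSupport P ↔ x ∉ P.support := by
  simp [offSupport]

theorem isOpen_offSupport : IsOpen (offSupport P) :=
  (Complex.isometry_ofReal.isClosedEmbedding.isClosedMap _ Measure.isClosed_support).isOpen_compl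

theorem exists_pos_forall_le_norm_sub {z : ℂ} (hz : z ∈ offSupport P) :
    ∃ δ > 0, ∀ w ∈ ball z δ, ∀ t ∈ P.support, δ ≤ ‖(t : ℂ) - w‖ := by
  obtain ⟨ε, hε, hball⟩ := Metric.isOpen_iff.1 isOpen_offSupport z hz
  refine ⟨ε / 2, half_pos hε, fun w hw t ht => ?_⟩
  by_contra! hlt
  have ht_mem : (t : ℂ) ∈ ball z ε :=
    calc dist (t : ℂ) z ≤ dist (t : ℂ) w + dist w z := dist_triangle _ _ _
    _ < ε / 2 + ε / 2 := add_lt_add (by rwa [dist_eq_norm]) hw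
    _ = ε := add_halves ε
  exact hball ht_mem ⟨t, ht, rfl⟩

theorem norm_one_div_le {𝕜 : Type*} [NormedField 𝕜] {δ : ℝ} (hδ : 0 < δ) {a : 𝕜}
    (h : δ ≤ ‖a‖) : ‖1 / a‖ ≤ 1 / δ := by
  rw [norm_div, norm_one]
  exact one_div_le_one_div_of_le hδ h

theorem memLp_top_one_div_sub {z : ℂ} (hz : z ∈ offSupport P) :
    MemLp (fun t : ℝ => 1 / ((t : ℂ) - z)) ⊤ P := by
  obtain ⟨δ, hδ, hle⟩ := exists_pos_forall_le_norm_sub hz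
  refine memLp_top_of_bound (Measurable.aestronglyMeasurable (by fun_prop)) (1 / δ) ?_
  filter_upwards [Measure.support_mem_ae] with t ht
  exact norm_one_div_le hδ (hle z (mem_ball_self hδ) t ht)

variable [IsFiniteMeasure P]

theorem continuousAt_stieltjes {z : ℂ} (hz : z ∈ offSupport P) :
    ContinuousAt (stieltjes P) z := by
  obtain ⟨δ, hδ, hle⟩ := exists_pos_forall_le_norm_sub hz
  refine continuousAt_of_dominated (bound := fun _ => 1 / δ)
    (Eventually.of_forall fun w => Measurable.aestronglyMeasurable (by fun_prop)) ?_
    (integrable_const _) ?_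
  · filter_upwards [ball_mem_nhds z hδ] with w hw
    filter_upwards [Measure.support_mem_ae] with t ht using norm_one_div_le hδ (hle w hw t ht)
  · filter_upwards [Measure.support_mem_ae] with t ht
    have : (t : ℂ) - z ≠ 0 := sub_ne_zero.2 fun h => hz ⟨t, ht, h⟩
    fun_prop (disch := assumption)

theorem stieltjes_sub {z w : ℂ} (hz : z ∈ offSupport P) (hw : w ∈ offSupport P) :
    stieltjes P z - stieltjes P w
      = (z - w) * ∫ t : ℝ, 1 / ((t : ℂ) - z) * (1 / ((t : ℂ) - w)) ∂P := by
  rw [stieltjes, stieltjes, ← integral_sub ((memLp_top_one_div_sub hz).integrable le_top)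
    ((memLp_top_one_div_sub hw).integrable le_top), ← integral_const_mul]
  refine integral_congr_ae ?_
  filter_upwards [Measure.support_mem_ae] with t ht
  have hz' : (t : ℂ) - z ≠ 0 := sub_ne_zero.2 fun h => hz ⟨t, ht, h⟩
  have hw' : (t : ℂ) - w ≠ 0 := sub_ne_zero.2 fun h => hw ⟨t, ht, h⟩
  field_simp
  ring

theorem integrable_sq_norm_one_div_sub {z : ℂ} (hz : z ∈ offSupport P) :
    Integrable (fun t : ℝ => ‖1 / ((t : ℂ) - z)‖ ^ 2) P := by
  have := (memLp_top_one_div_sub hz).mono_exponent (p := 2) le_top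
  exact (memLp_two_iff_integrable_sq_norm this.1).1 this

theorem im_stieltjes {z : ℂ} (hz : z ∈ offSupport P) :
    (stieltjes P z).im = z.im * ∫ t : ℝ, ‖1 / ((t : ℂ) - z)‖ ^ 2 ∂P := by
  rw [stieltjes, ← RCLike.im_eq_complex_im,
    ← integral_im ((memLp_top_one_div_sub hz).integrable le_top), ← integral_const_mul]
  refine integral_congr_ae (Eventually.of_forall fun t => ?_)
  simp [Complex.sq_norm, Complex.normSq_apply]
  ring_nf

theorem im_stieltjes_pos (hP : P ≠ 0) {z : ℂ} (hz : 0 < z.im) : 0 < (stieltjes P z).im := by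
  have hz' : z ∈ offSupport P := mem_offSupport_of_im_pos hz
  rw [im_stieltjes hz']
  refine mul_pos hz (integral_pos_of_ae_pos hP (integrable_sq_norm_one_div_sub hz') ?_)
  filter_upwards [Measure.support_mem_ae] with t ht
  have : (t : ℂ) - z ≠ 0 := sub_ne_zero.2 fun h => hz' ⟨t, ht, h⟩
  have := norm_pos_iff.2 (one_div_ne_zero this)
  positivity

theorem im_stieltjes_le {z : ℂ} (hz : 0 < z.im) {δ : ℝ} (hδ : 0 < δ)
    (hle : ∀ t ∈ P.support, δ ≤ ‖(t : ℂ) - z‖) :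
    (stieltjes P z).im ≤ z.im * (P.real univ / δ ^ 2) := by
  rw [im_stieltjes (mem_offSupport_of_im_pos hz)]
  gcongr
  calc ∫ t : ℝ, ‖1 / ((t : ℂ) - z)‖ ^ 2 ∂P ≤ ∫ _, (1 / δ) ^ 2 ∂P := by
        refine integral_mono_ae (integrable_sq_norm_one_div_sub (mem_offSupport_of_im_pos hz))
          (integrable_const _) ?_
        filter_upwards [Measure.support_mem_ae] with t ht
        gcongr
        exact norm_one_div_le hδ (hle t ht)
    _ = P.real univ / δ ^ 2 := by
        rw [integral_const, smul_eq_mul, one_div, inv_pow, div_eq_mul_inv]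

theorem isBigO_stieltjes_sub {z : ℂ} (hz : z ∈ offSupport P) :
    (fun w => stieltjes P w - stieltjes P z) =O[𝓝 z] fun w => w - z := by
  obtain ⟨δ, hδ, hle⟩ := exists_pos_forall_le_norm_sub hz
  refine IsBigO.of_bound (1 / δ * (1 / δ) * P.real univ) ?_
  filter_upwards [ball_mem_nhds z hδ, isOpen_offSupport.mem_nhds hz] with w hw hw'
  rw [stieltjes_sub hw' hz, norm_mul, mul_comm]
  gcongr
  refine norm_integral_le_of_norm_le_const ?_
  filter_upwards [Measure.support_mem_ae] with t ht
  rw [norm_mul]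
  gcongr
  exacts [norm_one_div_le hδ (hle w hw t ht), norm_one_div_le hδ (hle z (mem_ball_self hδ) t ht)]

theorem measureReal_closedBall_le_im_stieltjes {x η : ℝ} (hη : 0 < η) :
    P.real (closedBall x η) ≤ 2 * η * (stieltjes P (x + η * Complex.I)).im := by
  set z : ℂ := x + η * Complex.I with hz
  have him : z.im = η := by simp [hz]
  have hre : z.re = x := by simp [hz]
  have hmem : z ∈ offSupport P := mem_offSupport_of_im_pos (him ▸ hη)
  have hsub : closedBall x η ⊆ {t : ℝ | 1 / (2 * η ^ 2) ≤ ‖1 / ((t : ℂ) - z)‖ ^ 2} := by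
    intro t ht
    have hsq : ‖(t : ℂ) - z‖ ^ 2 = (t - x) ^ 2 + η ^ 2 := by
      rw [Complex.sq_norm, Complex.normSq_apply, Complex.sub_re, Complex.sub_im, hre, him]
      simp only [Complex.ofReal_re, Complex.ofReal_im]
      ring
    have hle : (t - x) ^ 2 ≤ η ^ 2 := sq_le_sq' (abs_le.1 ht).1 (abs_le.1 ht).2
    rw [mem_ofPred_eq, norm_div, norm_one, div_pow, one_pow, hsq]
    exact one_div_le_one_div_of_le (by positivity) (by linarith)
  have hmarkov := mul_meas_ge_le_integral_of_nonneg (Eventually.of_forall fun t => by positivity)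
    (integrable_sq_norm_one_div_sub hmem) (1 / (2 * η ^ 2))
  calc P.real (closedBall x η)
      ≤ P.real {t : ℝ | 1 / (2 * η ^ 2) ≤ ‖1 / ((t : ℂ) - z)‖ ^ 2} := measureReal_mono hsub
    _ = 2 * η * (η * (1 / (2 * η ^ 2) *
          P.real {t : ℝ | 1 / (2 * η ^ 2) ≤ ‖1 / ((t : ℂ) - z)‖ ^ 2})) := by field_simp
    _ ≤ 2 * η * (stieltjes P z).im := by
        rw [im_stieltjes hmem, him]
        gcongr

theorem ofReal_re_stieltjes (P : Measure ℝ) (x : ℝ) :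
    ((stieltjes P x).re : ℂ) = stieltjes P x := by
  have h : stieltjes P x = ((∫ t, 1 / (t - x) ∂P : ℝ) : ℂ) := by
    rw [stieltjes, ← integral_complex_ofReal]
    simp only [Complex.ofReal_div, Complex.ofReal_one, Complex.ofReal_sub]
  rw [h, Complex.ofReal_re]

theorem strictMonoOn_re_stieltjes (hP : P ≠ 0) {I : Set ℝ} (hI : I.OrdConnected)
    (hdisj : Disjoint I P.support) : StrictMonoOn (fun x : ℝ => (stieltjes P x).re) I := by
  intro x hx y hy hxy
  have hoff {v : ℝ} (hv : v ∈ I) : (v : ℂ) ∈ offSupport P :=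
    ofReal_mem_offSupport.2 (disjoint_left.1 hdisj hv)
  have hint := ((memLp_top_one_div_sub (hoff hy)).mono_exponent le_top).integrable_mul
    (p := 2) (q := 2) ((memLp_top_one_div_sub (hoff hx)).mono_exponent le_top)
  have hre : (stieltjes P y).re - (stieltjes P x).re
      = (y - x) * ∫ t : ℝ, (1 / ((t : ℂ) - y) * (1 / ((t : ℂ) - x))).re ∂P := by
    rw [← Complex.sub_re, stieltjes_sub (hoff hy) (hoff hx), ← Complex.ofReal_sub,
      Complex.re_ofReal_mul]
    exact congrArg _ (integral_re hint).symm
  refine sub_pos.1 (hre ▸ mul_pos (sub_pos.2 hxy) (integral_pos_of_ae_pos hP hint.re ?_))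
  filter_upwards [Measure.support_mem_ae] with t ht
  have hprod : 0 < (t - y) * (t - x) := by
    by_contra! hle
    have hmem : t ∈ Icc x y := by constructor <;> nlinarith
    exact disjoint_left.1 hdisj (hI.out hx hy hmem) ht
  have hcast : 1 / ((t : ℂ) - y) * (1 / ((t : ℂ) - x)) = ((1 / ((t - y) * (t - x)) : ℝ) : ℂ) := by
    push_cast
    rw [one_div_mul_one_div]
  change 0 < (1 / ((t : ℂ) - y) * (1 / ((t : ℂ) - x))).re
  rw [hcast, Complex.ofReal_re]
  positivity

theorem tendsto_ofReal_add_mul_I (s : ℝ) :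
    Tendsto (fun η : ℝ => (s + η * Complex.I : ℂ)) (𝓝[>] 0) (𝓝[upperHalfPlaneSet] s) :=
  tendsto_nhdsWithin_iff.2
    ⟨(Continuous.tendsto' (by fun_prop) 0 (s : ℂ) (by simp)).mono_left nhdsWithin_le_nhds,
      eventually_nhdsWithin_of_forall fun η hη => by simpa [mem_ofPred_eq] using hη⟩

instance neBot_nhdsWithin_upperHalfPlaneSet (s : ℝ) : (𝓝[upperHalfPlaneSet] (s : ℂ)).NeBot :=
  (tendsto_ofReal_add_mul_I s).neBot

theorem isBigO_measureReal_closedBall {s : ℝ}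
    (h : (fun z => (stieltjes P z).im) =O[𝓝[upperHalfPlaneSet] (s : ℂ)] Complex.im) :
    (fun η => P.real (closedBall s η)) =O[𝓝[>] 0] fun η => η ^ 2 := by
  have him : (fun η : ℝ => (stieltjes P (s + η * Complex.I)).im) =O[𝓝[>] 0] fun η => η := by
    simpa [Function.comp_def] using h.comp_tendsto (tendsto_ofReal_add_mul_I s)
  have hball : (fun η => P.real (closedBall s η)) =O[𝓝[>] 0]
      fun η => 2 * η * (stieltjes P (s + η * Complex.I)).im := by
    refine IsBigO.of_bound 1 ?_
    filter_upwards [self_mem_nhdsWithin] with η hη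
    rw [one_mul, Real.norm_of_nonneg measureReal_nonneg]
    exact (measureReal_closedBall_le_im_stieltjes hη).trans (le_abs_self _)
  refine hball.trans ?_
  simpa only [mul_assoc, sq] using ((isBigO_refl _ _).mul him).const_mul_left 2

theorem isBigO_neg_inv_stieltjes_sub {c : ℝ} (hc : c ≠ 0) {x : ℝ}
    (hx : x ∉ P.support) (hm : stieltjes P x ≠ 0) :
    (fun η : ℝ => -(c * stieltjes P (x + η * Complex.I))⁻¹ - -(c * stieltjes P x)⁻¹)
      =O[𝓝[>] 0] fun η => η := by
  have hoff := ofReal_mem_offSupport.2 hx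
  have hcm : (c * stieltjes P x : ℂ) ≠ 0 := mul_ne_zero (Complex.ofReal_ne_zero.2 hc) hm
  have hdiff : DifferentiableAt ℂ (fun m : ℂ => -(c * m)⁻¹) (stieltjes P x) := by
    fun_prop (disch := assumption)
  have hcomp := (hdiff.isBigO_sub.comp_tendsto (continuousAt_stieltjes hoff)).trans
    (isBigO_stieltjes_sub hoff)
  refine (hcomp.comp_tendsto ((tendsto_ofReal_add_mul_I x).mono_right nhdsWithin_le_nhds)).trans ?_
  exact IsBigO.of_bound 1 (Eventually.of_forall fun η => by simp)

end Stieltjes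

noncomputable section Weight

/-- The weight `c t m / (1 + c t m)` whose `G`-integrals express `u`, its difference quotients and
its derivative at a complex point `m`. -/
def weight (c : ℝ) (m : ℂ) (t : ℝ) : ℂ :=
  c * t * m / (1 + c * t * m)

/-- The integral of the squared modulus of the weight. At a real point `x` it equals
`c - c x² u'(x)`. -/
def energy (c : ℝ) (G : Measure ℝ) (m : ℂ) : ℝ :=
  ∫ t, ‖weight c m t‖ ^ 2 ∂G

/-- The function `u` at complex arguments. -/
def complexU (c : ℝ) (G : Measure ℝ) (m : ℂ) : ℂ :=
  -1 / m + ∫ t : ℝ, t / (1 + c * t * m) ∂G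

/-- The domain of `complexU`. -/
def complexDomain (c : ℝ) (G : Measure ℝ) : Set ℂ :=
  {m | m ≠ 0 ∧ ∀ t ∈ G.support, (1 + c * t * m : ℂ) ≠ 0}

variable {c : ℝ} {G : Measure ℝ} {m n : ℂ}

theorem one_add_ne_zero_of_im_ne_zero (c : ℝ) (hm : m.im ≠ 0) (t : ℝ) :
    (1 + c * t * m : ℂ) ≠ 0 := by
  intro h
  have him : c * t * m.im = 0 := by simpa using congrArg Complex.im h
  have hct : c * t = 0 := (mul_eq_zero.1 him).resolve_right hm
  rw [← Complex.ofReal_mul, hct] at h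
  simp at h

theorem mem_complexDomain_of_im_ne_zero (hm : m.im ≠ 0) : m ∈ complexDomain c G :=
  ⟨fun h => hm (by simp [h]), fun t _ => one_add_ne_zero_of_im_ne_zero c hm t⟩

theorem conj_mem_complexDomain (hm : m ∈ complexDomain c G) :
    (starRingEnd ℂ) m ∈ complexDomain c G := by
  refine ⟨(map_ne_zero _).2 hm.1, fun t ht h => hm.2 t ht ((map_eq_zero (starRingEnd ℂ)).1 ?_)⟩
  simpa using h

theorem weight_conj (c : ℝ) (m : ℂ) (t : ℝ) :
    weight c ((starRingEnd ℂ) m) t = (starRingEnd ℂ) (weight c m t) := by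
  simp [weight]

theorem complexU_conj (c : ℝ) (G : Measure ℝ) (m : ℂ) :
    complexU c G ((starRingEnd ℂ) m) = (starRingEnd ℂ) (complexU c G m) := by
  simp [complexU, ← integral_conj]

theorem complexU_eq (hc : c ≠ 0) (hm : m ≠ 0) :
    complexU c G m = ((∫ t, weight c m t ∂G) / c - 1) / m := by
  have hc' : (c : ℂ) ≠ 0 := Complex.ofReal_ne_zero.2 hc
  have hint : ∫ t, weight c m t ∂G = c * m * ∫ t : ℝ, t / (1 + c * t * m) ∂G := by
    rw [← integral_const_mul]
    refine integral_congr_ae (Eventually.of_forall fun t => ?_)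
    simp only [weight]
    ring
  rw [complexU, hint, mul_assoc, mul_div_cancel_left₀ _ hc', sub_div, mul_div_cancel_left₀ _ hm]
  ring

theorem one_add_eq_mul_sub (hc : c ≠ 0) (hm : m ≠ 0) (t : ℝ) :
    (1 + c * t * m : ℂ) = c * m * (t - -(c * m)⁻¹) := by
  have hcm : (c * m : ℂ) ≠ 0 := mul_ne_zero (Complex.ofReal_ne_zero.2 hc) hm
  rw [sub_neg_eq_add, mul_add, mul_inv_cancel₀ hcm]
  ring

theorem mem_complexDomain_iff (hc : c ≠ 0) :
    m ∈ complexDomain c G ↔ m ≠ 0 ∧ -(c * m)⁻¹ ∈ offSupport G := by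
  refine and_congr_right fun hm => ?_
  have hcm : (c * m : ℂ) ≠ 0 := mul_ne_zero (Complex.ofReal_ne_zero.2 hc) hm
  simp only [one_add_eq_mul_sub hc hm, mul_ne_zero_iff, ne_eq, hcm, not_false_eq_true, true_and,
    sub_eq_zero, offSupport, mem_compl_iff, mem_image, not_exists, not_and]

theorem exists_pos_eventually_le_norm_one_add (hc : c ≠ 0) (hm : m ∈ complexDomain c G) :
    ∃ δ > 0, ∀ᶠ n in 𝓝 m, ∀ t ∈ G.support, δ ≤ ‖(1 + c * t * n : ℂ)‖ := by
  have hcm : (c * m : ℂ) ≠ 0 := mul_ne_zero (Complex.ofReal_ne_zero.2 hc) hm.1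
  obtain ⟨δ, hδ, hle⟩ := exists_pos_forall_le_norm_sub ((mem_complexDomain_iff hc).1 hm).2
  have hpole : ∀ᶠ n : ℂ in 𝓝 m, -(c * n)⁻¹ ∈ ball (-(c * m)⁻¹) δ :=
    ContinuousAt.eventually_mem (by fun_prop (disch := assumption)) (ball_mem_nhds _ hδ)
  have hnorm : ∀ᶠ n : ℂ in 𝓝 m, ‖c * m‖ / 2 < ‖c * n‖ :=
    (ContinuousAt.tendsto (by fun_prop)).eventually_const_lt (half_lt_self (norm_pos_iff.2 hcm))
  refine ⟨‖c * m‖ / 2 * δ, by positivity, ?_⟩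
  filter_upwards [hpole, hnorm, eventually_ne_nhds hm.1] with n hn hn' hn0 t ht
  rw [one_add_eq_mul_sub hc hn0, norm_mul (c * n : ℂ)]
  exact mul_le_mul hn'.le (hle _ hn t ht) hδ.le (norm_nonneg _)

theorem isOpen_complexDomain (hc : c ≠ 0) : IsOpen (complexDomain c G) := by
  refine isOpen_iff_mem_nhds.2 fun m hm => ?_
  obtain ⟨δ, hδ, hle⟩ := exists_pos_eventually_le_norm_one_add hc hm
  filter_upwards [hle, eventually_ne_nhds hm.1] with n hn hn0
  exact ⟨hn0, fun t ht => norm_pos_iff.1 (hδ.trans_le (hn t ht))⟩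

theorem weight_eq_one_sub {t : ℝ} (h : (1 + c * t * m : ℂ) ≠ 0) :
    weight c m t = 1 - 1 / (1 + c * t * m) := by
  rw [weight, eq_sub_iff_add_eq, ← add_div, add_comm, div_self h]

theorem exists_eventually_norm_weight_le (hc : c ≠ 0) (hm : m ∈ complexDomain c G) :
    ∃ B : ℝ, ∀ᶠ n in 𝓝 m, ∀ t ∈ G.support, ‖weight c n t‖ ≤ B := by
  obtain ⟨δ, hδ, hle⟩ := exists_pos_eventually_le_norm_one_add hc hm
  refine ⟨1 + 1 / δ, hle.mono fun n hn t ht => ?_⟩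
  rw [weight_eq_one_sub (norm_pos_iff.1 (hδ.trans_le (hn t ht)))]
  calc ‖(1 - 1 / (1 + c * t * n) : ℂ)‖ ≤ ‖(1 : ℂ)‖ + ‖(1 / (1 + c * t * n) : ℂ)‖ := norm_sub_le _ _
    _ ≤ 1 + 1 / δ := by
        rw [norm_one]
        gcongr
        exact norm_one_div_le hδ (hn t ht)

theorem continuousAt_weight (hm : m ∈ complexDomain c G) {t : ℝ} (ht : t ∈ G.support) :
    ContinuousAt (fun n => weight c n t) m := by
  have := hm.2 t ht
  unfold weight
  fun_prop (disch := assumption)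

theorem aestronglyMeasurable_weight : AEStronglyMeasurable (weight c m) G :=
  Measurable.aestronglyMeasurable (by unfold weight; fun_prop)

variable [IsFiniteMeasure G]

theorem memLp_weight (hc : c ≠ 0) (hm : m ∈ complexDomain c G) : MemLp (weight c m) 2 G := by
  obtain ⟨B, hB⟩ := exists_eventually_norm_weight_le hc hm
  refine MemLp.of_bound aestronglyMeasurable_weight B ?_
  filter_upwards [Measure.support_mem_ae] with t ht using hB.self_of_nhds t ht

theorem integrable_sq_norm_weight (hc : c ≠ 0) (hm : m ∈ complexDomain c G) :
    Integrable (fun t => ‖weight c m t‖ ^ 2) G :=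
  (memLp_two_iff_integrable_sq_norm aestronglyMeasurable_weight).1 (memLp_weight hc hm)

theorem continuousAt_energy (hc : c ≠ 0) (hm : m ∈ complexDomain c G) :
    ContinuousAt (energy c G) m := by
  obtain ⟨B, hB⟩ := exists_eventually_norm_weight_le hc hm
  refine continuousAt_of_dominated (bound := fun _ => B ^ 2)
    (Eventually.of_forall fun n => aestronglyMeasurable_weight.norm.pow 2) ?_
    (integrable_const _) ?_
  · filter_upwards [hB] with n hn
    filter_upwards [Measure.support_mem_ae] with t ht
    rw [norm_pow, norm_norm]
    gcongr
    exact hn t ht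
  · filter_upwards [Measure.support_mem_ae] with t ht using (continuousAt_weight hm ht).norm.pow 2

theorem continuousAt_complexU (hc : c ≠ 0) (hm : m ∈ complexDomain c G) :
    ContinuousAt (complexU c G) m := by
  obtain ⟨B, hB⟩ := exists_eventually_norm_weight_le hc hm
  have hint : ContinuousAt (fun n => ∫ t, weight c n t ∂G) m := by
    refine continuousAt_of_dominated (bound := fun _ => B)
      (Eventually.of_forall fun n => aestronglyMeasurable_weight) ?_ (integrable_const _) ?_
    · filter_upwards [hB] with n hn
      filter_upwards [Measure.support_mem_ae] with t ht using hn t ht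
    · filter_upwards [Measure.support_mem_ae] with t ht using continuousAt_weight hm ht
  refine ContinuousAt.congr (f := fun n => ((∫ t, weight c n t ∂G) / c - 1) / n)
    (((hint.div_const _).sub_const 1).div continuousAt_id hm.1) ?_
  filter_upwards [eventually_ne_nhds hm.1] with n hn using (complexU_eq hc hn).symm

theorem integrable_div_one_add (hc : c ≠ 0) (hm : m ∈ complexDomain c G) :
    Integrable (fun t : ℝ => (t / (1 + c * t * m) : ℂ)) G := by
  refine (((memLp_weight hc hm).integrable one_le_two).div_const (c * m)).congr
    (Eventually.of_forall fun t => ?_)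
  have hc' : (c : ℂ) ≠ 0 := Complex.ofReal_ne_zero.2 hc
  have hm' := hm.1
  simp only [weight]
  field_simp

theorem complexU_sub (hc : c ≠ 0) (hm : m ∈ complexDomain c G) (hn : n ∈ complexDomain c G) :
    c * (complexU c G m - complexU c G n)
      = (n⁻¹ - m⁻¹) * (c - ∫ t, weight c m t * weight c n t ∂G) := by
  have hm0 := hm.1
  have hn0 := hn.1
  have hint : c * (∫ t : ℝ, (t / (1 + c * t * m) : ℂ) ∂G - ∫ t : ℝ, (t / (1 + c * t * n) : ℂ) ∂G)
      = (m⁻¹ - n⁻¹) * ∫ t, weight c m t * weight c n t ∂G := by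
    rw [← integral_sub (integrable_div_one_add hc hm) (integrable_div_one_add hc hn),
      ← integral_const_mul, ← integral_const_mul]
    refine integral_congr_ae ?_
    filter_upwards [Measure.support_mem_ae] with t ht
    have hmt := hm.2 t ht
    have hnt := hn.2 t ht
    simp only [weight]
    field_simp
    ring
  rw [complexU, complexU]
  linear_combination hint

theorem norm_integral_weight_mul_le (hc : c ≠ 0) (hm : m ∈ complexDomain c G)
    (hn : n ∈ complexDomain c G) :
    ‖∫ t, weight c m t * weight c n t ∂G‖ ≤ (energy c G m + energy c G n) / 2 := by
  have hm' := integrable_sq_norm_weight hc hm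
  have hn' := integrable_sq_norm_weight hc hn
  calc ‖∫ t, weight c m t * weight c n t ∂G‖
      ≤ ∫ t, (‖weight c m t‖ ^ 2 + ‖weight c n t‖ ^ 2) / 2 ∂G := by
        refine norm_integral_le_of_norm_le ((hm'.add hn').div_const 2)
          (Eventually.of_forall fun t => ?_)
        rw [norm_mul]
        linarith [two_mul_le_add_sq ‖weight c m t‖ ‖weight c n t‖]
    _ = (energy c G m + energy c G n) / 2 := by
        rw [integral_div, integral_add hm' hn', energy, energy]

theorem norm_inv_sub_inv_mul_le (hc : 0 < c) (hm : m ∈ complexDomain c G)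
    (hn : n ∈ complexDomain c G) (hm' : energy c G m ≤ c) :
    ‖m⁻¹ - n⁻¹‖ * ((c - energy c G n) / 2) ≤ c * ‖complexU c G m - complexU c G n‖ := by
  have hlower : (c - energy c G n) / 2 ≤ ‖(c - ∫ t, weight c m t * weight c n t ∂G : ℂ)‖ := by
    have := norm_sub_norm_le (c : ℂ) (∫ t, weight c m t * weight c n t ∂G)
    rw [Complex.norm_of_nonneg hc.le] at this
    linarith [norm_integral_weight_mul_le hc.ne' hm hn]
  calc ‖m⁻¹ - n⁻¹‖ * ((c - energy c G n) / 2)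
      ≤ ‖n⁻¹ - m⁻¹‖ * ‖(c - ∫ t, weight c m t * weight c n t ∂G : ℂ)‖ := by
        rw [norm_sub_rev]
        gcongr
    _ = c * ‖complexU c G m - complexU c G n‖ := by
        rw [← norm_mul, ← complexU_sub hc.ne' hm hn, norm_mul, Complex.norm_of_nonneg hc.le]

theorem im_complexU (hc : c ≠ 0) (hm : m ∈ complexDomain c G) :
    c * (complexU c G m).im = m.im / ‖m‖ ^ 2 * (c - energy c G m) := by
  have hsub := complexU_sub hc hm (conj_mem_complexDomain hm)
  have hint : ∫ t, weight c m t * weight c ((starRingEnd ℂ) m) t ∂G = energy c G m := by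
    rw [energy, ← integral_complex_ofReal]
    refine integral_congr_ae (Eventually.of_forall fun t => ?_)
    simp only [weight_conj, Complex.mul_conj, Complex.normSq_eq_norm_sq]
  rw [hint, complexU_conj, ← map_inv₀, Complex.sub_conj, ← neg_sub m⁻¹, Complex.sub_conj,
    Complex.inv_im, Complex.normSq_eq_norm_sq] at hsub
  refine Complex.ofReal_injective (mul_right_cancel₀ (b := 2 * Complex.I) (by simp) ?_)
  push_cast at hsub ⊢
  linear_combination hsub

theorem mul_measureReal_closedBall_le_energy (hc : c ≠ 0) (hm : m.im ≠ 0) {r η L : ℝ}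
    (hηr : η ≤ |r| / 2) (hL : ‖(r : ℂ) - -(c * m)⁻¹‖ ≤ L) :
    (|r| / 2 / (η + L)) ^ 2 * G.real (closedBall r η) ≤ energy c G m := by
  have hm0 : m ≠ 0 := fun h => hm (by simp [h])
  have hcm : (c * m : ℂ) ≠ 0 := mul_ne_zero (Complex.ofReal_ne_zero.2 hc) hm0
  have hsub : closedBall r η ⊆ {t | (|r| / 2 / (η + L)) ^ 2 ≤ ‖weight c m t‖ ^ 2} := by
    intro t ht
    rw [mem_closedBall, Real.dist_eq] at ht
    have hden : (t : ℂ) - -(c * m)⁻¹ ≠ 0 := fun h =>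
      one_add_ne_zero_of_im_ne_zero c hm t (by rw [one_add_eq_mul_sub hc hm0, h, mul_zero])
    have hweight : ‖weight c m t‖ = |t| / ‖(t : ℂ) - -(c * m)⁻¹‖ := by
      rw [weight, one_add_eq_mul_sub hc hm0, mul_right_comm, mul_div_mul_left _ _ hcm, norm_div,
        Complex.norm_real, Real.norm_eq_abs]
    have hnum : |r| / 2 ≤ |t| := by linarith [abs_sub_abs_le_abs_sub r t, abs_sub_comm r t]
    have hclose : ‖(t : ℂ) - -(c * m)⁻¹‖ ≤ η + L :=
      calc ‖(t : ℂ) - -(c * m)⁻¹‖ ≤ ‖(t : ℂ) - r‖ + ‖(r : ℂ) - -(c * m)⁻¹‖ :=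
            norm_sub_le_norm_sub_add_norm_sub _ _ _
        _ ≤ η + L := by
            rw [← Complex.ofReal_sub, Complex.norm_real, Real.norm_eq_abs]
            gcongr
    have hpos := norm_pos_iff.2 hden
    have hnonneg : 0 ≤ η + L := hpos.le.trans hclose
    rw [mem_ofPred_eq, hweight]
    gcongr
  calc (|r| / 2 / (η + L)) ^ 2 * G.real (closedBall r η)
      ≤ (|r| / 2 / (η + L)) ^ 2 *
          G.real {t | (|r| / 2 / (η + L)) ^ 2 ≤ ‖weight c m t‖ ^ 2} :=
        mul_le_mul_of_nonneg_left (measureReal_mono hsub) (sq_nonneg _)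
    _ ≤ energy c G m :=
        mul_meas_ge_le_integral_of_nonneg (Eventually.of_forall fun t => by positivity)
          (integrable_sq_norm_weight hc (mem_complexDomain_of_im_ne_zero hm)) _

end Weight

section Real

variable {c : ℝ} {G : Measure ℝ}

/-- The points of the domain of `u` at which `u` has positive derivative, expressed through
`c x² u'(x) = c - ∫ (c t x / (1 + c t x))² dG(t)` as in `criticalPoints`. -/
def increasingPoints (c : ℝ) (G : Measure ℝ) : Set ℝ :=
  {x ∈ uDomain c G | ∫ t, (c * t * x / (1 + c * t * x)) ^ 2 ∂G < c}

theorem ofReal_mem_complexDomain {x : ℝ} : (x : ℂ) ∈ complexDomain c G ↔ x ∈ uDomain c G := by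
  simp only [complexDomain, uDomain, mem_ofPred_eq]
  norm_cast

theorem complexU_ofReal (c : ℝ) (G : Measure ℝ) (x : ℝ) : complexU c G x = u c G x := by
  rw [complexU, u]
  push_cast
  rw [← integral_complex_ofReal]
  push_cast
  rfl

theorem energy_ofReal (c : ℝ) (G : Measure ℝ) (x : ℝ) :
    energy c G x = ∫ t, (c * t * x / (1 + c * t * x)) ^ 2 ∂G := by
  refine integral_congr_ae (Eventually.of_forall fun t => ?_)
  have h : weight c x t = ((c * t * x / (1 + c * t * x) : ℝ) : ℂ) := by
    simp only [weight]
    push_cast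
    rfl
  simp only [h, Complex.norm_real, Real.norm_eq_abs, sq_abs]

theorem mem_increasingPoints {x : ℝ} :
    x ∈ increasingPoints c G ↔ (x : ℂ) ∈ complexDomain c G ∧ energy c G x < c := by
  rw [ofReal_mem_complexDomain, energy_ofReal]
  rfl

variable [IsFiniteMeasure G]

theorem isOpen_increasingPoints (hc : c ≠ 0) : IsOpen (increasingPoints c G) := by
  refine isOpen_iff_mem_nhds.2 fun x hx => ?_
  obtain ⟨hdom, henergy⟩ := mem_increasingPoints.1 hx
  filter_upwards [Complex.continuous_ofReal.continuousAt.eventually_mem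
      ((isOpen_complexDomain hc).mem_nhds hdom),
    Complex.continuous_ofReal.continuousAt.eventually
      ((continuousAt_energy hc hdom).eventually_lt_const henergy)] with y hy hy'
  exact mem_increasingPoints.2 ⟨hy, hy'⟩

theorem injOn_u (hc : 0 < c) : InjOn (u c G) (increasingPoints c G) := by
  intro x hx y hy hxy
  obtain ⟨hx, hx'⟩ := mem_increasingPoints.1 hx
  obtain ⟨hy, hy'⟩ := mem_increasingPoints.1 hy
  have h := norm_inv_sub_inv_mul_le hc hx hy hx'.le
  rw [complexU_ofReal, complexU_ofReal, hxy, sub_self, norm_zero, mul_zero] at h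
  have hnorm : ‖(x : ℂ)⁻¹ - (y : ℂ)⁻¹‖ ≤ 0 := nonpos_of_mul_nonpos_left h (by linarith)
  rw [norm_le_zero_iff, sub_eq_zero, inv_inj] at hnorm
  exact_mod_cast hnorm

theorem continuousOn_u (hc : c ≠ 0) : ContinuousOn (u c G) (uDomain c G) := by
  intro x hx
  have h : ContinuousAt (fun y : ℝ => (complexU c G y).re) x :=
    Complex.continuous_re.continuousAt.comp
      ((continuousAt_complexU hc (ofReal_mem_complexDomain.2 hx)).comp
        Complex.continuous_ofReal.continuousAt)
  simp only [complexU_ofReal, Complex.ofReal_re] at h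
  exact h.continuousWithinAt

theorem image_u_mem_nhds (hc : 0 < c) {x : ℝ} (hx : x ∈ increasingPoints c G) :
    u c G '' increasingPoints c G ∈ 𝓝 (u c G x) :=
  image_mem_nhds_of_injOn ((isOpen_increasingPoints hc.ne').mem_nhds hx)
    ((continuousOn_u hc.ne').mono (sep_subset _ _)) (injOn_u hc)

end Real

namespace IsLSD

variable {c : ℝ} {G F : Measure ℝ} {z : ℂ}

theorem im_pos (hF : IsLSD c G F) (hz : 0 < z.im) : 0 < (stieltjes F z).im :=
  have := hF.isProbabilityMeasure
  im_stieltjes_pos (NeZero.ne F) hz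

theorem mem_complexDomain (hF : IsLSD c G F) (hz : 0 < z.im) :
    stieltjes F z ∈ complexDomain c G :=
  mem_complexDomain_of_im_ne_zero (hF.im_pos hz).ne'

theorem complexU_stieltjes (hF : IsLSD c G F) (hz : 0 < z.im) :
    complexU c G (stieltjes F z) = z :=
  (hF.equation z hz).symm

variable [IsFiniteMeasure G]

theorem mul_im (hF : IsLSD c G F) (hc : c ≠ 0) (hz : 0 < z.im) :
    c * z.im = (stieltjes F z).im / ‖stieltjes F z‖ ^ 2 * (c - energy c G (stieltjes F z)) := by
  rw [← im_complexU hc (hF.mem_complexDomain hz), hF.complexU_stieltjes hz]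

theorem energy_lt (hF : IsLSD c G F) (hc : 0 < c) (hz : 0 < z.im) :
    energy c G (stieltjes F z) < c := by
  have hnorm := norm_pos_iff.2 (hF.mem_complexDomain hz).1
  have hpos : 0 < (stieltjes F z).im / ‖stieltjes F z‖ ^ 2 := div_pos (hF.im_pos hz) (by positivity)
  exact sub_pos.1 (pos_of_mul_pos_right (hF.mul_im hc.ne' hz ▸ mul_pos hc hz) hpos.le)

theorem tendsto_stieltjes (hF : IsLSD c G F) (hc : 0 < c) {x : ℝ}
    (hx : x ∈ increasingPoints c G) :
    Tendsto (stieltjes F) (𝓝[upperHalfPlaneSet] (u c G x : ℂ)) (𝓝 x) := by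
  obtain ⟨hdom, henergy⟩ := mem_increasingPoints.1 hx
  have hgap : 0 < (c - energy c G x) / 2 := by linarith
  have hbound : ∀ᶠ z in 𝓝[upperHalfPlaneSet] (u c G x : ℂ),
      ‖(stieltjes F z)⁻¹ - (x : ℂ)⁻¹‖ ≤ c * ‖z - u c G x‖ / ((c - energy c G x) / 2) := by
    filter_upwards [self_mem_nhdsWithin] with z hz
    rw [le_div_iff₀ hgap]
    have := norm_inv_sub_inv_mul_le hc (hF.mem_complexDomain hz) hdom (hF.energy_lt hc hz).le
    rwa [hF.complexU_stieltjes hz, complexU_ofReal] at this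
  have hzero : Tendsto (fun z : ℂ => c * ‖z - u c G x‖ / ((c - energy c G x) / 2))
      (𝓝[upperHalfPlaneSet] (u c G x : ℂ)) (𝓝 0) :=
    (Continuous.tendsto' (by fun_prop) _ _ (by simp)).mono_left nhdsWithin_le_nhds
  have hinv := tendsto_iff_norm_sub_tendsto_zero.2
    (squeeze_zero' (Eventually.of_forall fun z => norm_nonneg _) hbound hzero)
  simpa only [inv_inv] using hinv.inv₀ (inv_ne_zero hdom.1)

theorem isBigO_im_stieltjes (hF : IsLSD c G F) (hc : 0 < c) {x : ℝ}
    (hx : x ∈ increasingPoints c G) :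
    (fun z => (stieltjes F z).im) =O[𝓝[upperHalfPlaneSet] (u c G x : ℂ)] Complex.im := by
  obtain ⟨hdom, henergy⟩ := mem_increasingPoints.1 hx
  have hlim := hF.tendsto_stieltjes hc hx
  have hratio : Tendsto
      (fun z => c * ‖stieltjes F z‖ ^ 2 / (c - energy c G (stieltjes F z)))
      (𝓝[upperHalfPlaneSet] (u c G x : ℂ)) (𝓝 (c * ‖(x : ℂ)‖ ^ 2 / (c - energy c G x))) :=
    ((hlim.norm.pow 2).const_mul c).div
      (((continuousAt_energy hc.ne' hdom).tendsto.comp hlim).const_sub c) (sub_pos.2 henergy).ne'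
  have hproduct := (isBigO_refl Complex.im (𝓝[upperHalfPlaneSet] (u c G x : ℂ))).mul
    (hratio.isBigO_one ℝ)
  simp only [mul_one] at hproduct
  refine hproduct.congr' ?_ EventuallyEq.rfl
  filter_upwards [self_mem_nhdsWithin] with z hz
  have hnorm := norm_ne_zero_iff.2 (hF.mem_complexDomain hz).1
  have hgap := (sub_pos.2 (hF.energy_lt hc hz)).ne'
  have := hF.mul_im hc.ne' hz
  field_simp at this ⊢
  linear_combination this

theorem image_subset_compl_support (hF : IsLSD c G F) (hc : 0 < c) :
    u c G '' increasingPoints c G ⊆ F.supportᶜ := by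
  have := hF.isProbabilityMeasure
  rintro _ ⟨x, hx, rfl⟩
  refine notMem_support_of_isBigO ?_
  filter_upwards [image_u_mem_nhds hc hx]
  rintro _ ⟨y, hy, rfl⟩
  exact isBigO_measureReal_closedBall (hF.isBigO_im_stieltjes hc hy)

theorem stieltjes_ne_zero (hF : IsLSD c G F) (hc : 0 < c) {s : ℝ} (hs : s ∉ F.support) :
    stieltjes F s ≠ 0 := by
  have := hF.isProbabilityMeasure
  intro hzero
  have hlim : Tendsto (stieltjes F) (𝓝[upperHalfPlaneSet] (s : ℂ)) (𝓝 0) := by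
    simpa only [hzero] using
      (continuousAt_stieltjes (ofReal_mem_offSupport.2 hs)).tendsto.mono_left nhdsWithin_le_nhds
  have hweight : Tendsto (fun z => ∫ t, weight c (stieltjes F z) t ∂G)
      (𝓝[upperHalfPlaneSet] (s : ℂ)) (𝓝 0) := by
    refine tendsto_integral_zero_of_memLp_two (C := c) ?_ ?_ (Eventually.of_forall fun t => ?_)
    · filter_upwards [self_mem_nhdsWithin] with z hz
        using memLp_weight hc.ne' (hF.mem_complexDomain hz)
    · filter_upwards [self_mem_nhdsWithin] with z hz using (hF.energy_lt hc hz).le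
    · have hcont : ContinuousAt (fun m => weight c m t) 0 := by
        have : (1 + c * t * 0 : ℂ) ≠ 0 := by simp
        unfold weight
        fun_prop (disch := assumption)
      simpa [weight, Function.comp_def] using hcont.tendsto.comp hlim
  have hequation : Tendsto (fun z => c * (1 + z * stieltjes F z))
      (𝓝[upperHalfPlaneSet] (s : ℂ)) (𝓝 0) := by
    refine hweight.congr' ?_
    filter_upwards [self_mem_nhdsWithin] with z hz
    have hm := (hF.mem_complexDomain hz).1
    have hc' : (c : ℂ) ≠ 0 := Complex.ofReal_ne_zero.2 hc.ne'
    have h := hF.complexU_stieltjes hz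
    rw [complexU_eq hc.ne' hm] at h
    field_simp at h
    linear_combination h
  have hid : Tendsto (fun z : ℂ => z) (𝓝[upperHalfPlaneSet] (s : ℂ)) (𝓝 s) := nhdsWithin_le_nhds
  have hc_lim := ((hid.mul hlim).const_add 1).const_mul (c : ℂ)
  simp only [mul_zero, add_zero, mul_one] at hc_lim
  exact hc.ne' (Complex.ofReal_eq_zero.1 (tendsto_nhds_unique hc_lim hequation))

theorem isBigO_measureReal_closedBall_neg_inv (hF : IsLSD c G F) (hc : 0 < c) {x : ℝ}
    (hx : x ∉ F.support) (hm : stieltjes F x ≠ 0) :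
    (fun η => G.real (closedBall (-(c * (stieltjes F x).re)⁻¹) η)) =O[𝓝[>] 0] fun η => η ^ 2 := by
  have := hF.isProbabilityMeasure
  set r : ℝ := -(c * (stieltjes F x).re)⁻¹ with hr
  have hrm : (r : ℂ) = -(c * stieltjes F x)⁻¹ := by
    rw [hr]
    push_cast
    rw [ofReal_re_stieltjes]
  have hr0 : r ≠ 0 := by
    rw [← Complex.ofReal_ne_zero, hrm]
    exact neg_ne_zero.2 (inv_ne_zero (mul_ne_zero (Complex.ofReal_ne_zero.2 hc.ne') hm))
  have hrpos := abs_pos.2 hr0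
  obtain ⟨K, hK, hbound⟩ := (isBigO_neg_inv_stieltjes_sub hc.ne' hx hm).exists_pos
  refine IsBigO.of_bound ((2 * (1 + K) / |r|) ^ 2 * c) ?_
  filter_upwards [hbound.bound, Ioo_mem_nhdsGT (half_pos hrpos)] with η hη hη'
  obtain ⟨hη0, hηr⟩ := hη'
  have him : 0 < (x + η * Complex.I : ℂ).im := by simpa using hη0
  rw [← hrm, norm_sub_rev, Real.norm_eq_abs, abs_of_pos hη0] at hη
  have henergy := (mul_measureReal_closedBall_le_energy (G := G) hc.ne' (hF.im_pos him).ne'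
    hηr.le hη).trans (hF.energy_lt hc him).le
  rw [Real.norm_of_nonneg measureReal_nonneg, Real.norm_of_nonneg (sq_nonneg η)]
  calc G.real (closedBall r η)
      = (2 * (1 + K) / |r| * η) ^ 2 *
          ((|r| / 2 / (η + K * η)) ^ 2 * G.real (closedBall r η)) := by
        field_simp
    _ ≤ (2 * (1 + K) / |r| * η) ^ 2 * c := by gcongr
    _ = (2 * (1 + K) / |r|) ^ 2 * c * η ^ 2 := by ring

theorem stieltjes_mem_complexDomain (hF : IsLSD c G F) (hc : 0 < c) {s : ℝ}
    (hs : s ∉ F.support) : stieltjes F s ∈ complexDomain c G := by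
  have := hF.isProbabilityMeasure
  refine (mem_complexDomain_iff hc.ne').2 ⟨hF.stieltjes_ne_zero hc hs, ?_⟩
  have hre {x : ℝ} (hx : x ∉ F.support) : (stieltjes F x).re ≠ 0 := by
    rw [← Complex.ofReal_ne_zero, ofReal_re_stieltjes]
    exact hF.stieltjes_ne_zero hc hx
  obtain ⟨ε, hε, hball⟩ := Metric.isOpen_iff.1 Measure.isClosed_support.isOpen_compl s hs
  have hcont : ContinuousOn (fun x : ℝ => -(c * (stieltjes F x).re)⁻¹) (ball s ε) := fun x hx =>
    (((Complex.continuous_re.continuousAt.comp ((continuousAt_stieltjes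
      (ofReal_mem_offSupport.2 (hball hx))).comp Complex.continuous_ofReal.continuousAt)).const_mul
      c).inv₀ (mul_ne_zero hc.ne' (hre (hball hx)))).neg.continuousWithinAt
  have hinj : InjOn (fun x : ℝ => -(c * (stieltjes F x).re)⁻¹) (ball s ε) := fun x hx y hy hxy =>
    (strictMonoOn_re_stieltjes (NeZero.ne F) (convex_ball s ε).ordConnected
      (disjoint_left.2 hball)).injOn hx hy (mul_left_cancel₀ hc.ne' (inv_inj.1 (neg_inj.1 hxy)))
  have hnot := notMem_support_of_isBigO (P := G)
    (mem_of_superset (image_mem_nhds_of_injOn (ball_mem_nhds s hε) hcont hinj)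
      (image_subset_iff.2 fun x hx => hF.isBigO_measureReal_closedBall_neg_inv hc (hball hx)
        (hF.stieltjes_ne_zero hc (hball hx))))
  rw [← ofReal_mem_offSupport] at hnot
  push_cast at hnot
  rwa [ofReal_re_stieltjes] at hnot

theorem complexU_stieltjes_of_notMem_support (hF : IsLSD c G F) (hc : 0 < c) {s : ℝ}
    (hs : s ∉ F.support) : complexU c G (stieltjes F s) = s := by
  have := hF.isProbabilityMeasure
  have hlim := (continuousAt_stieltjes (ofReal_mem_offSupport.2 hs)).tendsto.mono_left
    (nhdsWithin_le_nhds (s := upperHalfPlaneSet))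
  refine tendsto_nhds_unique ((continuousAt_complexU hc.ne'
    (hF.stieltjes_mem_complexDomain hc hs)).tendsto.comp hlim) ?_
  refine Tendsto.congr' (f₁ := id) ?_ nhdsWithin_le_nhds
  filter_upwards [self_mem_nhdsWithin] with z hz using (hF.complexU_stieltjes hz).symm

theorem energy_stieltjes_lt (hF : IsLSD c G F) (hc : 0 < c) {s : ℝ} (hs : s ∉ F.support) :
    energy c G (stieltjes F s) < c := by
  have := hF.isProbabilityMeasure
  have hoff := ofReal_mem_offSupport.2 hs
  obtain ⟨δ, hδ, hle⟩ := exists_pos_forall_le_norm_sub hoff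
  have hm := (continuousAt_stieltjes hoff).tendsto.mono_left
    (nhdsWithin_le_nhds (s := upperHalfPlaneSet))
  have hlim := (continuousAt_energy hc.ne' (hF.stieltjes_mem_complexDomain hc hs)).tendsto.comp hm
  have hbound : ∀ᶠ z in 𝓝[upperHalfPlaneSet] (s : ℂ),
      energy c G (stieltjes F z) ≤ c - c * δ ^ 2 * ‖stieltjes F z‖ ^ 2 := by
    filter_upwards [self_mem_nhdsWithin, nhdsWithin_le_nhds (ball_mem_nhds (s : ℂ) hδ)]
      with z hz hzs
    have him := im_stieltjes_le hz hδ (hle z hzs)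
    rw [probReal_univ, mul_one_div, le_div_iff₀ (by positivity)] at him
    have hnorm := norm_pos_iff.2 (hF.mem_complexDomain hz).1
    have hbalance := hF.mul_im hc.ne' hz
    rw [div_mul_eq_mul_div, eq_div_iff (by positivity)] at hbalance
    refine le_of_mul_le_mul_left ?_ (hF.im_pos hz)
    nlinarith [mul_le_mul_of_nonneg_left him (mul_nonneg hc.le (sq_nonneg ‖stieltjes F z‖))]
  refine (le_of_tendsto_of_tendsto hlim (((hm.norm.pow 2).const_mul (c * δ ^ 2)).const_sub c)
    hbound).trans_lt (sub_lt_self c ?_)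
  have := norm_pos_iff.2 (hF.stieltjes_ne_zero hc hs)
  positivity

theorem compl_support_eq (hF : IsLSD c G F) (hc : 0 < c) :
    F.supportᶜ = u c G '' increasingPoints c G := by
  refine Subset.antisymm (fun s hs => ⟨(stieltjes F s).re, ?_, ?_⟩)
    (hF.image_subset_compl_support hc)
  · rw [mem_increasingPoints, ofReal_re_stieltjes]
    exact ⟨hF.stieltjes_mem_complexDomain hc hs, hF.energy_stieltjes_lt hc hs⟩
  · have h := hF.complexU_stieltjes_of_notMem_support hc hs
    rw [← ofReal_re_stieltjes, complexU_ofReal] at h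
    exact_mod_cast h

end IsLSD

noncomputable section RatioSum

/-- The integral `∫ (t / (r + t))² dG(t)` for the two-point distribution `G`. With `r = 1 / (c x)`
it is the integral `∫ (c t x / (1 + c t x))² dG(t)` of `criticalPoints`. -/
def ratioSum (p q a b r : ℝ) : ℝ :=
  p * (a / (r + a)) ^ 2 + q * (b / (r + b)) ^ 2

/-- The function `u` for the two-point distribution in the coordinate `r = 1 / (c x)`, extended
to `r = 0`, which is the point `x = ∞`. -/
def uInv (c p q a b r : ℝ) : ℝ :=
  -c * r + (p * (a * r / (r + a)) + q * (b * r / (r + b)))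

/-- The common domain of `ratioSum` and `uInv`. -/
def offPoles (a b : ℝ) : Set ℝ :=
  {r | r + a ≠ 0 ∧ r + b ≠ 0}

/-- The points at which `uInv` has negative derivative `ratioSum - c`. -/
def subcritical (c p q a b : ℝ) : Set ℝ :=
  {r ∈ offPoles a b | ratioSum p q a b r < c}

/-- The critical points of `uInv`, whose derivative is `ratioSum - c`. -/
def levelSet (c p q a b : ℝ) : Set ℝ :=
  {r ∈ offPoles a b | ratioSum p q a b r = c}

variable {c p q a b r : ℝ}

theorem ratioSum_swap (p q a b r : ℝ) : ratioSum p q a b r = ratioSum q p b a r :=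
  add_comm _ _

theorem ratioSum_neg (p q a b r : ℝ) : ratioSum p q a b (-r) = ratioSum p q (-a) (-b) r := by
  simp only [ratioSum, ← neg_div_neg_eq a, ← neg_div_neg_eq b, neg_add, neg_neg]

theorem uInv_neg (c p q a b r : ℝ) : uInv c p q a b (-r) = -uInv c p q (-a) (-b) r := by
  have h (t : ℝ) : t * -r / (-r + t) = -(-t * r / (r + -t)) := by
    rw [← neg_div_neg_eq (t * -r), ← neg_div]
    ring_nf
  simp only [uInv, h]
  ring

theorem ratioSum_zero (ha : a ≠ 0) (hb : b ≠ 0) : ratioSum p q a b 0 = p + q := by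
  simp [ratioSum, ha, hb]

theorem continuousOn_ratioSum : ContinuousOn (ratioSum p q a b) (offPoles a b) := by
  rintro r ⟨hra, hrb⟩
  unfold ratioSum
  fun_prop (disch := assumption)

theorem continuousOn_uInv : ContinuousOn (uInv c p q a b) (offPoles a b) := by
  rintro r ⟨hra, hrb⟩
  unfold uInv
  fun_prop (disch := assumption)

theorem tendsto_div_add_atTop (t : ℝ) : Tendsto (fun r => t / (r + t)) atTop (𝓝 0) :=
  tendsto_const_nhds.div_atTop (tendsto_atTop_add_const_right atTop t tendsto_id)

theorem tendsto_ratioSum_atTop : Tendsto (ratioSum p q a b) atTop (𝓝 0) := by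
  unfold ratioSum
  simpa using (((tendsto_div_add_atTop a).pow 2).const_mul p).add
    (((tendsto_div_add_atTop b).pow 2).const_mul q)

theorem tendsto_uInv_atTop (hc : 0 < c) : Tendsto (uInv c p q a b) atTop atBot := by
  have hlim := ((((tendsto_div_add_atTop a).const_sub 1).const_mul (p * a)).add
    (((tendsto_div_add_atTop b).const_sub 1).const_mul (q * b)))
  refine ((tendsto_id.const_mul_atTop_of_neg (neg_neg_of_pos hc)).atBot_add hlim).congr' ?_
  filter_upwards [eventually_gt_atTop (-a), eventually_gt_atTop (-b)] with r hra hrb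
  have hra' : r + a ≠ 0 := by linarith
  have hrb' : r + b ≠ 0 := by linarith
  rw [uInv, id]
  field_simp
  ring

theorem tendsto_uInv_atBot (hc : 0 < c) : Tendsto (uInv c p q a b) atBot atTop := by
  simpa [Function.comp_def, ← uInv_neg] using
    tendsto_neg_atBot_atTop.comp ((tendsto_uInv_atTop (p := p) (q := q) (a := -a) (b := -b) hc).comp
      tendsto_neg_atBot_atTop)

theorem tendsto_ratioSum_neg_left (hp : 0 < p) (hq : 0 ≤ q) (ha : a ≠ 0) :
    Tendsto (ratioSum p q a b) (𝓝[≠] (-a)) atTop := by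
  have hshift : Tendsto (fun r => r + a) (𝓝[≠] (-a)) (𝓝[≠] 0) :=
    tendsto_nhdsWithin_iff.2
      ⟨(Continuous.tendsto' (by fun_prop) _ _ (by simp)).mono_left nhdsWithin_le_nhds,
        eventually_nhdsWithin_of_forall fun r hr h => hr (eq_neg_of_add_eq_zero_left h)⟩
  have hsquare : Tendsto (fun r => (a / (r + a)) ^ 2) (𝓝[≠] (-a)) atTop := by
    have hnorm := tendsto_norm_inv_nhdsNE_zero_atTop.comp hshift
    refine (((tendsto_pow_atTop two_ne_zero).comp hnorm).const_mul_atTop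
      (show 0 < a ^ 2 by positivity)).congr fun r => ?_
    simp [div_eq_mul_inv, mul_pow]
  exact tendsto_atTop_mono (fun r => le_add_of_nonneg_right (by positivity))
    (hsquare.const_mul_atTop hp)

theorem tendsto_ratioSum_neg_right (hp : 0 ≤ p) (hq : 0 < q) (hb : b ≠ 0) :
    Tendsto (ratioSum p q a b) (𝓝[≠] (-b)) atTop :=
  (tendsto_ratioSum_neg_left hq hp hb).congr fun r => ratioSum_swap q p b a r

theorem uInv_sub {s : ℝ} (hr : r ∈ offPoles a b) (hs : s ∈ offPoles a b) :
    uInv c p q a b r - uInv c p q a b s =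
      (s - r) * (c - (p * (a / (r + a) * (a / (s + a))) + q * (b / (r + b) * (b / (s + b))))) := by
  obtain ⟨hra, hrb⟩ := hr
  obtain ⟨hsa, hsb⟩ := hs
  unfold uInv
  field_simp
  ring

-- AM-GM bounds the mixed products in `uInv_sub` by the mean of the two values of `ratioSum`.
theorem strictAntiOn_uInv (hp : 0 < p) (hq : 0 ≤ q) (ha : a ≠ 0) :
    StrictAntiOn (uInv c p q a b) (subcritical c p q a b ∪ levelSet c p q a b) := by
  have hmem {r : ℝ} (hr : r ∈ subcritical c p q a b ∪ levelSet c p q a b) :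
      r ∈ offPoles a b ∧ ratioSum p q a b r ≤ c :=
    hr.elim (fun h => ⟨h.1, h.2.le⟩) fun h => ⟨h.1, h.2.le⟩
  intro r hr s hs hrs
  obtain ⟨⟨hroff, hr⟩, hsoff, hs⟩ := And.intro (hmem hr) (hmem hs)
  rw [← sub_pos, uInv_sub hroff hsoff]
  refine mul_pos (sub_pos.2 hrs) ?_
  have hne : a / (r + a) - a / (s + a) ≠ 0 := by
    rw [sub_ne_zero, Ne, div_eq_mul_inv, div_eq_mul_inv, mul_right_inj' ha, inv_inj, add_left_inj]
    exact hrs.ne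
  have hstrict : 0 < p * (a / (r + a) - a / (s + a)) ^ 2 := by positivity
  have hweak : 0 ≤ q * (b / (r + b) - b / (s + b)) ^ 2 := by positivity
  unfold ratioSum at hr hs
  linarith

theorem image_uInv_Ioi (hc : 0 < c) (hp : 0 < p) (hq : 0 ≤ q) (ha : a ≠ 0)
    (hsub : Ioi r ⊆ subcritical c p q a b) (hr : r ∈ levelSet c p q a b) :
    uInv c p q a b '' Ioi r = Iio (uInv c p q a b r) := by
  have hIci : Ici r ⊆ subcritical c p q a b ∪ levelSet c p q a b := by
    rw [← Ioi_union_left]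
    exact union_subset_union hsub (singleton_subset_iff.2 hr)
  exact (continuousOn_uInv.mono (hIci.trans (union_subset (sep_subset _ _) (sep_subset _ _))))
    |>.image_Ioi_of_strictAntiOn ((strictAntiOn_uInv hp hq ha).mono hIci) (tendsto_uInv_atTop hc)

theorem image_uInv_Iio (hc : 0 < c) (hp : 0 < p) (hq : 0 ≤ q) (ha : a ≠ 0)
    (hsub : Iio r ⊆ subcritical c p q a b) (hr : r ∈ levelSet c p q a b) :
    uInv c p q a b '' Iio r = Ioi (uInv c p q a b r) := by
  have hIic : Iic r ⊆ subcritical c p q a b ∪ levelSet c p q a b := by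
    rw [← Iio_union_right]
    exact union_subset_union hsub (singleton_subset_iff.2 hr)
  exact (continuousOn_uInv.mono (hIic.trans (union_subset (sep_subset _ _) (sep_subset _ _))))
    |>.image_Iio_of_strictAntiOn ((strictAntiOn_uInv hp hq ha).mono hIic) (tendsto_uInv_atBot hc)

theorem image_uInv_Ioo (hp : 0 < p) (hq : 0 ≤ q) (ha : a ≠ 0) {s : ℝ} (hrs : r ≤ s)
    (hsub : Ioo r s ⊆ subcritical c p q a b) (hr : r ∈ levelSet c p q a b)
    (hs : s ∈ levelSet c p q a b) :
    uInv c p q a b '' Ioo r s = Ioo (uInv c p q a b s) (uInv c p q a b r) := by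
  have hIcc : Icc r s ⊆ subcritical c p q a b ∪ levelSet c p q a b := by
    rw [← Ioo_union_both hrs]
    exact union_subset_union hsub (pair_subset hr hs)
  exact (continuousOn_uInv.mono (hIcc.trans (union_subset (sep_subset _ _) (sep_subset _ _))))
    |>.image_Ioo_of_strictAntiOn hrs ((strictAntiOn_uInv hp hq ha).mono hIcc)

theorem uInv_of_mem_levelSet (hr : r ∈ levelSet c p q a b) :
    uInv c p q a b r = p * a * (r / (r + a)) ^ 2 + q * b * (r / (r + b)) ^ 2 := by
  obtain ⟨⟨hra, hrb⟩, rfl⟩ := hr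
  unfold uInv ratioSum
  field_simp
  ring

theorem uInv_nonneg (hp : 0 ≤ p) (hq : 0 ≤ q) (ha : 0 ≤ a) (hb : 0 ≤ b)
    (hr : r ∈ levelSet c p q a b) : 0 ≤ uInv c p q a b r := by
  rw [uInv_of_mem_levelSet hr]
  positivity

theorem uInv_eq_zero_iff (hp : 0 < p) (hq : 0 ≤ q) (ha : 0 < a) (hb : 0 ≤ b)
    (hr : r ∈ levelSet c p q a b) : uInv c p q a b r = 0 ↔ r = 0 := by
  rw [uInv_of_mem_levelSet hr, add_eq_zero_iff_of_nonneg (by positivity) (by positivity)]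
  have hra := hr.1.1
  constructor
  · rintro ⟨h, -⟩
    simpa [hp.ne', ha.ne', hra] using h
  · rintro rfl
    simp

theorem zero_mem_levelSet_iff (hpq : p + q = 1) (ha : a ≠ 0) (hb : b ≠ 0) :
    0 ∈ levelSet c p q a b ↔ c = 1 := by
  simp [levelSet, offPoles, ratioSum_zero, ha, hb, hpq, eq_comm]

theorem exists_right_edge (hc : 0 < c) (hp : 0 < p) (hq : 0 ≤ q) (ha : a ≠ 0) (hab : a ≤ b) :
    ∃ r₁ ∈ Ioi (-a), ∀ r ∈ Ioi (-a),
      (ratioSum p q a b r < c ↔ r₁ < r) ∧ (ratioSum p q a b r = c ↔ r = r₁) := by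
  have hpos {r : ℝ} (hr : r ∈ Ioi (-a)) : 0 < r + a ∧ 0 < r + b := by
    rw [mem_Ioi] at hr
    constructor <;> linarith
  have hanti : StrictAntiOn (ratioSum p q a b) (Ioi (-a)) := by
    intro r hr s _ hrs
    obtain ⟨hra, hrb⟩ := hpos hr
    unfold ratioSum
    simp only [div_pow]
    refine add_lt_add_of_lt_of_le ?_ ?_ <;> gcongr
  obtain ⟨r₁, hr₁, rfl⟩ := isPreconnected_Ioi.intermediate_value_Ioi
    (le_principal_iff.2 (Ioi_mem_atTop _)) (le_principal_iff.2 self_mem_nhdsWithin)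
    (continuousOn_ratioSum.mono fun r hr => ⟨(hpos hr).1.ne', (hpos hr).2.ne'⟩)
    tendsto_ratioSum_atTop
    ((tendsto_ratioSum_neg_left hp hq ha).mono_left (nhdsGT_le_nhdsNE _)) hc
  exact ⟨r₁, hr₁, fun r hr => ⟨hanti.lt_iff_gt hr hr₁, hanti.injOn.eq_iff hr hr₁⟩⟩

theorem exists_left_edge (hc : 0 < c) (hp : 0 ≤ p) (hq : 0 < q) (hb : b ≠ 0) (hab : a ≤ b) :
    ∃ r₄ ∈ Iio (-b), ∀ r ∈ Iio (-b),
      (ratioSum p q a b r < c ↔ r < r₄) ∧ (ratioSum p q a b r = c ↔ r = r₄) := by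
  obtain ⟨s, hs, hedge⟩ := exists_right_edge hc hq hp (neg_ne_zero.2 hb) (neg_le_neg hab)
  rw [neg_neg, mem_Ioi] at hs
  refine ⟨-s, neg_lt_neg hs, fun r hr => ?_⟩
  have h := hedge (-r) (by rw [mem_Iio] at hr; simpa using lt_neg.2 hr)
  rwa [← ratioSum_neg, neg_neg, ratioSum_swap, lt_neg, neg_eq_iff_eq_neg] at h

/-- The zero of `p * a ^ 2 / (r + a) ^ 3 + q * b ^ 2 / (r + b) ^ 3`, at which `ratioSum p q a b`
attains its minimum between its two poles; the formula solves
`(p * a ^ 2) ^ (1 / 3) / (r + a) = -(q * b ^ 2) ^ (1 / 3) / (r + b)`. -/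
def middleRoot (p q a b : ℝ) : ℝ :=
  -((p * a ^ 2) ^ (3⁻¹ : ℝ) * b + (q * b ^ 2) ^ (3⁻¹ : ℝ) * a) /
    ((p * a ^ 2) ^ (3⁻¹ : ℝ) + (q * b ^ 2) ^ (3⁻¹ : ℝ))

theorem middleRoot_mem_Ioo (hp : 0 < p) (hq : 0 < q) (ha : a ≠ 0) (hb : b ≠ 0) (hab : a < b) :
    middleRoot p q a b ∈ Ioo (-b) (-a) := by
  have hA : 0 < (p * a ^ 2) ^ (3⁻¹ : ℝ) := by positivity
  have hB : 0 < (q * b ^ 2) ^ (3⁻¹ : ℝ) := by positivity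
  have hA' := mul_lt_mul_of_pos_left hab hA
  have hB' := mul_lt_mul_of_pos_left hab hB
  rw [middleRoot, mem_Ioo, lt_div_iff₀ (by positivity), div_lt_iff₀ (by positivity)]
  constructor <;> linarith

theorem middleRoot_neg (hp : 0 < p) (hq : 0 < q) (ha : 0 < a) (hb : 0 < b) :
    middleRoot p q a b < 0 :=
  div_neg_of_neg_of_pos (neg_neg_of_pos (by positivity)) (by positivity)

-- The factorization `x³ + y³ = (x + y) (x² - x y + y²)`, whose second factor is positive.
theorem exists_pos_mul_sub_middleRoot (hp : 0 < p) (hq : 0 < q) (ha : a ≠ 0) (hb : b ≠ 0)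
    (hr : r ∈ offPoles a b) :
    ∃ K > 0, p * a ^ 2 / (r + a) ^ 3 + q * b ^ 2 / (r + b) ^ 3 =
      K * ((r - middleRoot p q a b) / ((r + a) * (r + b))) := by
  obtain ⟨hra, hrb⟩ := hr
  have hcube {x : ℝ} (hx : 0 ≤ x) : (x ^ (3⁻¹ : ℝ)) ^ 3 = x := by
    exact_mod_cast Real.rpow_inv_natCast_pow hx three_ne_zero
  have hA : 0 < (p * a ^ 2) ^ (3⁻¹ : ℝ) := by positivity
  have hB : 0 < (q * b ^ 2) ^ (3⁻¹ : ℝ) := by positivity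
  have hA3 := hcube (show 0 ≤ p * a ^ 2 by positivity)
  have hB3 := hcube (show 0 ≤ q * b ^ 2 by positivity)
  unfold middleRoot
  set A := (p * a ^ 2) ^ (3⁻¹ : ℝ)
  set B := (q * b ^ 2) ^ (3⁻¹ : ℝ)
  have hquad : 0 < (A / (r + a)) ^ 2 - A / (r + a) * (B / (r + b)) + (B / (r + b)) ^ 2 := by
    have hx : 0 < (A / (r + a)) ^ 2 := by positivity
    linarith [sq_nonneg (A / (r + a) - 2 * (B / (r + b)))]
  refine ⟨(A + B) * _, mul_pos (by positivity) hquad, ?_⟩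
  rw [← hA3, ← hB3]
  field_simp
  ring

theorem sum_div_cube_eq_zero_iff (hp : 0 < p) (hq : 0 < q) (ha : a ≠ 0) (hb : b ≠ 0)
    (hr : r ∈ offPoles a b) :
    p * a ^ 2 / (r + a) ^ 3 + q * b ^ 2 / (r + b) ^ 3 = 0 ↔ r = middleRoot p q a b := by
  obtain ⟨K, hK, h⟩ := exists_pos_mul_sub_middleRoot hp hq ha hb hr
  simp [h, hK.ne', hr.1, hr.2, sub_eq_zero]

theorem hasDerivAt_ratioSum (hr : r ∈ offPoles a b) :
    HasDerivAt (ratioSum p q a b)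
      (-2 * (p * a ^ 2 / (r + a) ^ 3 + q * b ^ 2 / (r + b) ^ 3)) r := by
  have h (s t : ℝ) (ht : r + t ≠ 0) :
      HasDerivAt (fun r => s * (t / (r + t)) ^ 2) (-2 * (s * t ^ 2 / (r + t) ^ 3)) r := by
    refine ((((hasDerivAt_const r t).fun_div ((hasDerivAt_id' r).add_const t) ht).fun_pow 2
      |>.const_mul s)).congr_deriv ?_
    simp only [Nat.add_one_sub_one, pow_one]
    field_simp
    ring
  exact ((h p a hr.1).add (h q b hr.2)).congr_deriv (by ring)

theorem Ioo_subset_offPoles : Ioo (-b) (-a) ⊆ offPoles a b :=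
  fun _ hr => ⟨by linarith [hr.2], by linarith [hr.1]⟩

theorem strictAntiOn_ratioSum_middle (hp : 0 < p) (hq : 0 < q) (ha : a ≠ 0) (hb : b ≠ 0)
    (hab : a < b) : StrictAntiOn (ratioSum p q a b) (Ioc (-b) (middleRoot p q a b)) := by
  have hρ := middleRoot_mem_Ioo hp hq ha hb hab
  have hsub : Ioc (-b) (middleRoot p q a b) ⊆ offPoles a b :=
    (Ioc_subset_Ioo_right hρ.2).trans Ioo_subset_offPoles
  refine strictAntiOn_of_deriv_neg (convex_Ioc _ _) (continuousOn_ratioSum.mono hsub) fun r hr => ?_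
  rw [interior_Ioc] at hr
  have hroff := hsub (Ioo_subset_Ioc_self hr)
  obtain ⟨K, hK, h⟩ := exists_pos_mul_sub_middleRoot hp hq ha hb hroff
  rw [(hasDerivAt_ratioSum hroff).deriv, h]
  have : 0 < (r - middleRoot p q a b) / ((r + a) * (r + b)) :=
    div_pos_of_neg_of_neg (by linarith [hr.2])
      (mul_neg_of_neg_of_pos (by linarith [hr.2, hρ.2]) (by linarith [hr.1]))
  exact mul_neg_of_neg_of_pos (by norm_num) (mul_pos hK this)

theorem strictMonoOn_ratioSum_middle (hp : 0 < p) (hq : 0 < q) (ha : a ≠ 0) (hb : b ≠ 0)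
    (hab : a < b) : StrictMonoOn (ratioSum p q a b) (Ico (middleRoot p q a b) (-a)) := by
  have hρ := middleRoot_mem_Ioo hp hq ha hb hab
  have hsub : Ico (middleRoot p q a b) (-a) ⊆ offPoles a b :=
    (Ico_subset_Ioo_left hρ.1).trans Ioo_subset_offPoles
  refine strictMonoOn_of_deriv_pos (convex_Ico _ _) (continuousOn_ratioSum.mono hsub) fun r hr => ?_
  rw [interior_Ico] at hr
  have hroff := hsub (Ioo_subset_Ico_self hr)
  obtain ⟨K, hK, h⟩ := exists_pos_mul_sub_middleRoot hp hq ha hb hroff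
  rw [(hasDerivAt_ratioSum hroff).deriv, h]
  have : (r - middleRoot p q a b) / ((r + a) * (r + b)) < 0 :=
    div_neg_of_pos_of_neg (by linarith [hr.1])
      (mul_neg_of_neg_of_pos (by linarith [hr.2]) (by linarith [hr.1, hρ.1]))
  exact mul_pos_of_neg_of_neg (by norm_num) (mul_neg_of_pos_of_neg hK this)

theorem ratioSum_middleRoot_lt (hp : 0 < p) (hq : 0 < q) (ha : a ≠ 0) (hb : b ≠ 0)
    (hab : a < b) (hr : r ∈ Ioo (-b) (-a)) (hne : r ≠ middleRoot p q a b) :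
    ratioSum p q a b (middleRoot p q a b) < ratioSum p q a b r := by
  have hρ := middleRoot_mem_Ioo hp hq ha hb hab
  rcases hne.lt_or_gt with h | h
  · exact strictAntiOn_ratioSum_middle hp hq ha hb hab ⟨hr.1, h.le⟩ (right_mem_Ioc.2 hρ.1) h
  · exact strictMonoOn_ratioSum_middle hp hq ha hb hab (left_mem_Ico.2 hρ.2) ⟨h.le, hr.2⟩ h

theorem exists_middle_edges (hp : 0 < p) (hq : 0 < q) (ha : a ≠ 0) (hb : b ≠ 0) (hab : a < b)
    (hc : ratioSum p q a b (middleRoot p q a b) < c) :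
    ∃ r₃ r₂, -b < r₃ ∧ r₃ < r₂ ∧ r₂ < -a ∧ ∀ r ∈ Ioo (-b) (-a),
      (ratioSum p q a b r < c ↔ r ∈ Ioo r₃ r₂) ∧ (ratioSum p q a b r = c ↔ r = r₃ ∨ r = r₂) := by
  obtain ⟨hρb, hρa⟩ := middleRoot_mem_Ioo hp hq ha hb hab
  have hanti := strictAntiOn_ratioSum_middle hp hq ha hb hab
  have hmono := strictMonoOn_ratioSum_middle hp hq ha hb hab
  set ρ := middleRoot p q a b
  have hcont : ContinuousOn (ratioSum p q a b) (Ioo (-b) (-a)) :=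
    continuousOn_ratioSum.mono Ioo_subset_offPoles
  obtain ⟨r₃, hr₃, rfl⟩ := isPreconnected_Ioc.intermediate_value_Ici (right_mem_Ioc.2 hρb)
    (le_principal_iff.2 (Ioc_mem_nhdsGT hρb)) (hcont.mono (Ioc_subset_Ioo_right hρa))
    ((tendsto_ratioSum_neg_right hp.le hq hb).mono_left (nhdsGT_le_nhdsNE _)) hc.le
  obtain ⟨r₂, hr₂, h₂⟩ := isPreconnected_Ico.intermediate_value_Ici (left_mem_Ico.2 hρa)
    (le_principal_iff.2 (Ico_mem_nhdsLT hρa)) (hcont.mono (Ico_subset_Ioo_left hρb))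
    ((tendsto_ratioSum_neg_left hp hq.le ha).mono_left (nhdsLT_le_nhdsNE _)) hc.le
  have h₃ρ : r₃ < ρ := (hanti.lt_iff_gt (right_mem_Ioc.2 hρb) hr₃).1 hc
  have hρ₂ : ρ < r₂ := (hmono.lt_iff_lt (left_mem_Ico.2 hρa) hr₂).1 (h₂ ▸ hc)
  refine ⟨r₃, r₂, hr₃.1, h₃ρ.trans hρ₂, hr₂.2, fun r hr => ?_⟩
  rcases le_total r ρ with h | h
  · have hr' : r ∈ Ioc (-b) ρ := ⟨hr.1, h⟩
    rw [hanti.lt_iff_gt hr' hr₃, hanti.injOn.eq_iff hr' hr₃, mem_Ioo,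
      and_iff_left (h.trans_lt hρ₂), or_iff_left (h.trans_lt hρ₂).ne]
    exact ⟨Iff.rfl, Iff.rfl⟩
  · have hr' : r ∈ Ico ρ (-a) := ⟨h, hr.2⟩
    rw [← h₂, hmono.lt_iff_lt hr' hr₂, hmono.injOn.eq_iff hr' hr₂, mem_Ioo,
      and_iff_right (h₃ρ.trans_le h), or_iff_right (h₃ρ.trans_le h).ne']
    exact ⟨Iff.rfl, Iff.rfl⟩

theorem exists_four_edges (hc : 0 < c) (hp : 0 < p) (hq : 0 < q) (ha : a ≠ 0) (hb : b ≠ 0)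
    (hab : a < b) (hmin : ratioSum p q a b (middleRoot p q a b) < c) :
    ∃ r₄ r₃ r₂ r₁, r₄ < r₃ ∧ r₃ < r₂ ∧ r₂ < r₁ ∧ r₂ < -a ∧
      subcritical c p q a b = Iio r₄ ∪ Ioo r₃ r₂ ∪ Ioi r₁ ∧
      levelSet c p q a b = {r₁, r₂, r₃, r₄} := by
  obtain ⟨r₁, h₁, hright⟩ := exists_right_edge hc hp hq.le ha hab.le
  obtain ⟨r₃, r₂, h₃, h₃₂, h₂, hmiddle⟩ := exists_middle_edges hp hq ha hb hab hmin
  obtain ⟨r₄, h₄, hleft⟩ := exists_left_edge hc hp.le hq hb hab.le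
  simp only [mem_Ioi, mem_Iio, mem_Ioo] at h₁ h₄ hright hmiddle hleft
  refine ⟨r₄, r₃, r₂, r₁, by linarith, h₃₂, by linarith, h₂, ?_, ?_⟩ <;> ext r <;>
    specialize hright r <;> specialize hmiddle r <;> specialize hleft r <;>
    simp only [subcritical, levelSet, offPoles, mem_ofPred_eq, mem_union, mem_Iio, mem_Ioo, mem_Ioi,
      mem_insert_iff, mem_singleton_iff] <;> grind

theorem exists_two_edges (hc : 0 < c) (hp : 0 < p) (hq : 0 < q) (ha : a ≠ 0) (hb : b ≠ 0)
    (hab : a < b) (hmin : c ≤ ratioSum p q a b (middleRoot p q a b)) :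
    ∃ r₄ r₁, r₄ < -b ∧ -a < r₁ ∧ subcritical c p q a b = Iio r₄ ∪ Ioi r₁ ∧
      levelSet c p q a b \ {middleRoot p q a b} = {r₁, r₄} := by
  obtain ⟨r₁, h₁, hright⟩ := exists_right_edge hc hp hq.le ha hab.le
  obtain ⟨r₄, h₄, hleft⟩ := exists_left_edge hc hp.le hq hb hab.le
  have hρ := middleRoot_mem_Ioo hp hq ha hb hab
  have hmiddle {r : ℝ} (hr : r ∈ Ioo (-b) (-a)) (hne : r ≠ middleRoot p q a b) :
      c < ratioSum p q a b r :=
    hmin.trans_lt (ratioSum_middleRoot_lt hp hq ha hb hab hr hne)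
  simp only [mem_Ioi, mem_Iio, mem_Ioo] at h₁ h₄ hright hmiddle hleft hρ
  refine ⟨r₄, r₁, h₄, h₁, ?_, ?_⟩ <;> ext r <;>
    specialize hright r <;> specialize @hmiddle r <;> specialize hleft r <;>
    simp only [subcritical, levelSet, offPoles, mem_ofPred_eq, mem_union, mem_Iio, mem_Ioi,
      Set.mem_sdiff, mem_insert_iff, mem_singleton_iff] <;> grind

theorem compl_Iio_union_Ioo_union_Ioi {s₁ s₂ s₃ s₄ : ℝ} (h₁₂ : s₁ ≤ s₂) (h₂₃ : s₂ < s₃)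
    (h₃₄ : s₃ ≤ s₄) : (Iio s₁ ∪ Ioo s₂ s₃ ∪ Ioi s₄)ᶜ = Icc s₁ s₂ ∪ Icc s₃ s₄ := by
  ext x
  simp only [mem_compl_iff, mem_union, mem_Iio, mem_Ioo, mem_Ioi, mem_Icc]
  grind

theorem uInv_eq_zero_iff_eq_one (hp : 0 < p) (hq : 0 ≤ q) (hpq : p + q = 1) (ha : 0 < a)
    (hb : 0 < b) (hr : r ∈ levelSet c p q a b)
    (hone : c = 1 → r = 0) : uInv c p q a b r = 0 ↔ c = 1 := by
  rw [uInv_eq_zero_iff hp hq ha hb.le hr]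
  exact ⟨fun h => (zero_mem_levelSet_iff hpq ha.ne' hb.ne').1 (h ▸ hr), hone⟩

theorem image_uInv_Iio_union_Ioo_union_Ioi (hc : 0 < c) (hp : 0 < p) (hq : 0 ≤ q) (ha : a ≠ 0)
    {r₁ r₂ r₃ r₄ : ℝ} (h₃₂ : r₃ ≤ r₂)
    (hsub : Iio r₄ ∪ Ioo r₃ r₂ ∪ Ioi r₁ ⊆ subcritical c p q a b)
    (hlev : {r₁, r₂, r₃, r₄} ⊆ levelSet c p q a b) :
    uInv c p q a b '' (Iio r₄ ∪ Ioo r₃ r₂ ∪ Ioi r₁) =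
      Iio (uInv c p q a b r₁) ∪ Ioo (uInv c p q a b r₂) (uInv c p q a b r₃) ∪
        Ioi (uInv c p q a b r₄) := by
  simp only [union_subset_iff, insert_subset_iff, singleton_subset_iff] at hsub hlev
  obtain ⟨⟨hleft, hmiddle⟩, hright⟩ := hsub
  obtain ⟨hr₁, hr₂, hr₃, hr₄⟩ := hlev
  rw [image_union, image_union, image_uInv_Iio hc hp hq ha hleft hr₄,
    image_uInv_Ioo hp hq ha h₃₂ hmiddle hr₃ hr₂, image_uInv_Ioi hc hp hq ha hright hr₁,
    union_comm, union_comm (Ioi _), union_assoc]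

theorem exists_four_endpoints (hc : 0 < c) (hp : 0 < p) (hq : 0 < q) (hpq : p + q = 1)
    (ha : 0 < a) (hab : a < b) (hmin : ratioSum p q a b (middleRoot p q a b) < c) :
    ∃ s₁ s₂ s₃ s₄, 0 ≤ s₁ ∧ s₁ < s₂ ∧ s₂ < s₃ ∧ s₃ < s₄ ∧ (s₁ = 0 ↔ c = 1) ∧
      (c ≠ 1 → uInv c p q a b '' (levelSet c p q a b \ {0}) = {s₁, s₂, s₃, s₄}) ∧
      (c = 1 → uInv c p q a b '' (levelSet c p q a b \ {0}) = {s₂, s₃, s₄}) ∧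
      (uInv c p q a b '' subcritical c p q a b)ᶜ = Icc s₁ s₂ ∪ Icc s₃ s₄ := by
  have hb := ha.trans hab
  obtain ⟨r₄, r₃, r₂, r₁, h₄₃, h₃₂, h₂₁, h₂, hsub, hlev⟩ :=
    exists_four_edges hc hp hq ha.ne' hb.ne' hab hmin
  obtain ⟨hr₁, hr₂, hr₃, hr₄⟩ : r₁ ∈ levelSet c p q a b ∧ r₂ ∈ levelSet c p q a b ∧
      r₃ ∈ levelSet c p q a b ∧ r₄ ∈ levelSet c p q a b := by simp [hlev]
  have hanti : StrictAntiOn (uInv c p q a b) (levelSet c p q a b) :=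
    (strictAntiOn_uInv hp hq.le ha.ne').mono subset_union_right
  have h₁₂ := hanti hr₂ hr₁ h₂₁
  have h₂₃ := hanti hr₃ hr₂ h₃₂
  have h₃₄ := hanti hr₄ hr₃ h₄₃
  have hzero (hc1 : c = 1) : r₁ = 0 := by
    have h := (zero_mem_levelSet_iff hpq ha.ne' hb.ne').2 hc1
    simp only [hlev, mem_insert_iff, mem_singleton_iff] at h
    grind
  refine ⟨_, _, _, _, uInv_nonneg hp.le hq.le ha.le hb.le hr₁, h₁₂, h₂₃, h₃₄,
    uInv_eq_zero_iff_eq_one hp hq.le hpq ha hb hr₁ hzero, fun hc1 => ?_, fun hc1 => ?_, ?_⟩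
  · rw [sdiff_singleton_eq_self (mt (zero_mem_levelSet_iff hpq ha.ne' hb.ne').1 hc1), hlev]
    simp only [image_insert_eq, image_singleton]
  · rw [hlev, hzero hc1, insert_sdiff_self_of_notMem]
    · simp only [image_insert_eq, image_singleton]
    · simp only [mem_insert_iff, mem_singleton_iff]
      grind
  · rw [hsub, image_uInv_Iio_union_Ioo_union_Ioi hc hp hq.le ha.ne' h₃₂.le hsub.ge hlev.ge,
      compl_Iio_union_Ioo_union_Ioi h₁₂.le h₂₃ h₃₄.le]

theorem exists_two_endpoints (hc : 0 < c) (hp : 0 < p) (hq : 0 < q) (hpq : p + q = 1)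
    (ha : 0 < a) (hab : a < b) (hmin : c ≤ ratioSum p q a b (middleRoot p q a b)) :
    ∃ s₁ s₄, 0 ≤ s₁ ∧ s₁ < s₄ ∧ (s₁ = 0 ↔ c = 1) ∧
      (c ≠ 1 →
        uInv c p q a b '' ((levelSet c p q a b \ {middleRoot p q a b}) \ {0}) = {s₁, s₄}) ∧
      (c = 1 → uInv c p q a b '' ((levelSet c p q a b \ {middleRoot p q a b}) \ {0}) = {s₄}) ∧
      (uInv c p q a b '' subcritical c p q a b)ᶜ = Icc s₁ s₄ := by
  have hb := ha.trans hab
  obtain ⟨r₄, r₁, h₄, h₁, hsub, hlev⟩ := exists_two_edges hc hp hq ha.ne' hb.ne' hab hmin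
  obtain ⟨hr₁, hr₄⟩ : r₁ ∈ levelSet c p q a b ∧ r₄ ∈ levelSet c p q a b := by
    constructor <;> exact sdiff_subset (hlev.ge (by simp))
  have hlevel_zero : 0 ∈ levelSet c p q a b \ {middleRoot p q a b} ↔ c = 1 := by
    rw [Set.mem_sdiff, zero_mem_levelSet_iff hpq ha.ne' hb.ne', mem_singleton_iff,
      and_iff_left (middleRoot_neg hp hq ha hb).ne']
  have hzero (hc1 : c = 1) : r₁ = 0 := by
    have h := hlevel_zero.2 hc1
    simp only [hlev, mem_insert_iff, mem_singleton_iff] at h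
    grind
  refine ⟨_, _, uInv_nonneg hp.le hq.le ha.le hb.le hr₁,
    strictAntiOn_uInv hp hq.le ha.ne' (.inr hr₄) (.inr hr₁) (by linarith),
    uInv_eq_zero_iff_eq_one hp hq.le hpq ha hb hr₁ hzero, fun hc1 => ?_, fun hc1 => ?_, ?_⟩
  · rw [sdiff_singleton_eq_self (mt hlevel_zero.1 hc1), hlev, image_pair]
  · rw [hlev, hzero hc1, insert_sdiff_self_of_notMem, image_singleton]
    exact (by linarith : r₄ < 0).ne'
  · obtain ⟨hleft, hright⟩ := union_subset_iff.1 hsub.ge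
    rw [hsub, image_union, image_uInv_Iio hc hp hq.le ha.ne' hleft hr₄,
      image_uInv_Ioi hc hp hq.le ha.ne' hright hr₁, compl_union, compl_Ioi, compl_Iio,
      inter_comm, Ici_inter_Iic]

end RatioSum

section TwoAtom

open scoped ENNReal

variable {c p q a b r : ℝ}

instance : IsFiniteMeasure (twoAtom p q a b) :=
  ⟨by simp [twoAtom]⟩

theorem twoAtom_swap (p q a b : ℝ) : twoAtom p q a b = twoAtom q p b a :=
  add_comm _ _

theorem support_smul_dirac {w : ℝ≥0∞} (hw : w ≠ 0) (t : ℝ) :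
    (w • Measure.dirac t).support = {t} := by
  refine Subset.antisymm (Measure.support_subset_of_isClosed isClosed_singleton ?_) ?_
  · simp [mem_ae_iff]
  · rw [singleton_subset_iff, Measure.mem_support_iff_forall]
    intro U hU
    simp [Measure.dirac_apply_of_mem (mem_of_mem_nhds hU), pos_iff_ne_zero, hw]

theorem support_twoAtom (hp : 0 < p) (hq : 0 < q) : (twoAtom p q a b).support = {a, b} := by
  rw [twoAtom, Measure.support_add, support_smul_dirac (by simpa using hp),
    support_smul_dirac (by simpa using hq), singleton_union]

theorem integral_twoAtom (hp : 0 ≤ p) (hq : 0 ≤ q) (φ : ℝ → ℝ) :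
    ∫ t, φ t ∂(twoAtom p q a b) = p * φ a + q * φ b := by
  have hint (w t : ℝ) : Integrable φ (ENNReal.ofReal w • Measure.dirac t) :=
    (integrable_dirac (by simp)).smul_measure ENNReal.ofReal_ne_top
  rw [twoAtom, integral_add_measure (hint p a) (hint q b)]
  simp [integral_smul_measure, hp, hq]

theorem one_add_mul_inv (hr : r ≠ 0) (t : ℝ) : 1 + t * r⁻¹ = (r + t) * r⁻¹ := by
  field_simp

theorem isCriticalRoot_twoAtom_inv_iff (hp : 0 < p) (hq : 0 < q) (hr : r ≠ 0) :
    IsCriticalRoot (twoAtom p q a b) r⁻¹ ↔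
      r ∈ offPoles a b ∧ p * a ^ 2 / (r + a) ^ 3 + q * b ^ 2 / (r + b) ^ 3 = 0 := by
  rw [IsCriticalRoot, support_twoAtom hp hq, integral_twoAtom hp.le hq.le]
  have hscale : p * (a ^ 2 / (1 + a * r⁻¹) ^ 3) + q * (b ^ 2 / (1 + b * r⁻¹) ^ 3) =
      r ^ 3 * (p * a ^ 2 / (r + a) ^ 3 + q * b ^ 2 / (r + b) ^ 3) := by
    simp only [one_add_mul_inv hr, mul_pow, inv_pow, div_mul_eq_div_div, div_inv_eq_mul]
    ring
  rw [hscale]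
  simp [one_add_mul_inv hr, hr, offPoles]

theorem isCriticalRoot_twoAtom_iff (hp : 0 < p) (hq : 0 < q) (ha : 0 < a) (hab : a < b) {x : ℝ} :
    IsCriticalRoot (twoAtom p q a b) x ↔ x = (middleRoot p q a b)⁻¹ := by
  have hb := ha.trans hab
  have hρ := middleRoot_mem_Ioo hp hq ha.ne' hb.ne' hab
  rcases eq_or_ne x 0 with rfl | hx
  · have hpos : 0 < p * a ^ 2 + q * b ^ 2 := by positivity
    simp [IsCriticalRoot, integral_twoAtom hp.le hq.le, hpos.ne', (middleRoot_neg hp hq ha hb).ne']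
  · rw [← inv_inv x, isCriticalRoot_twoAtom_inv_iff hp hq (inv_ne_zero hx), inv_inj,
      and_congr_right fun h => sum_div_cube_eq_zero_iff hp hq ha.ne' hb.ne' h,
      and_iff_right_of_imp fun h => h ▸ Ioo_subset_offPoles hρ]

theorem criticalRatio_twoAtom_inv (hp : 0 ≤ p) (hq : 0 ≤ q) (hr : r ≠ 0) :
    criticalRatio (twoAtom p q a b) r⁻¹ = ratioSum p q a b r := by
  simp only [criticalRatio, integral_twoAtom hp hq, ratioSum, one_add_mul_inv hr, ← div_pow,
    mul_div_mul_right _ _ (inv_ne_zero hr)]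

theorem mul_mul_inv_mul (hc : c ≠ 0) (r t : ℝ) : c * t * (c * r)⁻¹ = t * r⁻¹ := by
  field_simp

theorem u_twoAtom (hc : c ≠ 0) (hp : 0 ≤ p) (hq : 0 ≤ q) (hr : r ≠ 0) :
    u c (twoAtom p q a b) (c * r)⁻¹ = uInv c p q a b r := by
  simp only [u, integral_twoAtom hp hq, uInv, mul_mul_inv_mul hc, one_add_mul_inv hr,
    div_mul_eq_div_div, div_inv_eq_mul]
  ring

theorem integral_sq_twoAtom (hc : c ≠ 0) (hp : 0 ≤ p) (hq : 0 ≤ q) (hr : r ≠ 0) :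
    ∫ t, (c * t * (c * r)⁻¹ / (1 + c * t * (c * r)⁻¹)) ^ 2 ∂(twoAtom p q a b) =
      ratioSum p q a b r := by
  simp only [integral_twoAtom hp hq, ratioSum, mul_mul_inv_mul hc, one_add_mul_inv hr,
    mul_div_mul_right _ _ (inv_ne_zero hr)]

theorem inv_mul_mem_uDomain_twoAtom (hc : c ≠ 0) (hp : 0 < p) (hq : 0 < q) :
    (c * r)⁻¹ ∈ uDomain c (twoAtom p q a b) ↔ r ∈ offPoles a b \ {0} := by
  rcases eq_or_ne r 0 with rfl | hr
  · simp [uDomain]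
  · simp only [uDomain, offPoles, support_twoAtom hp hq, mem_ofPred_eq, mul_mul_inv_mul hc,
      one_add_mul_inv hr]
    simp [hc, hr]

theorem involutive_inv_mul (hc : c ≠ 0) : Function.Involutive fun r => (c * r)⁻¹ := fun r => by
  change (c * (c * r)⁻¹)⁻¹ = r
  rw [mul_inv, inv_inv, inv_mul_cancel_left₀ hc]

theorem criticalPoints_twoAtom (hc : c ≠ 0) (hp : 0 < p) (hq : 0 < q) :
    criticalPoints c (twoAtom p q a b) = (fun r => (c * r)⁻¹) '' (levelSet c p q a b \ {0}) := by
  rw [← image_preimage_eq (criticalPoints c _) (involutive_inv_mul hc).surjective]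
  congr 1
  ext r
  rw [mem_preimage, criticalPoints, mem_ofPred_eq, inv_mul_mem_uDomain_twoAtom hc hp hq, levelSet,
    Set.mem_sdiff, Set.mem_sdiff, mem_ofPred_eq, and_right_comm]
  refine and_congr_left fun hr => and_congr_right fun _ => ?_
  rw [integral_sq_twoAtom hc hp.le hq.le hr, sub_eq_zero, eq_comm]

theorem increasingPoints_twoAtom (hc : c ≠ 0) (hp : 0 < p) (hq : 0 < q) :
    increasingPoints c (twoAtom p q a b) =
      (fun r => (c * r)⁻¹) '' (subcritical c p q a b \ {0}) := by
  rw [← image_preimage_eq (increasingPoints c _) (involutive_inv_mul hc).surjective]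
  congr 1
  ext r
  rw [mem_preimage, increasingPoints, mem_ofPred_eq, inv_mul_mem_uDomain_twoAtom hc hp hq,
    subcritical, Set.mem_sdiff, Set.mem_sdiff, mem_ofPred_eq, and_right_comm]
  refine and_congr_left fun hr => and_congr_right fun _ => ?_
  rw [integral_sq_twoAtom hc hp.le hq.le hr]

theorem image_u_twoAtom (hc : c ≠ 0) (hp : 0 ≤ p) (hq : 0 ≤ q) (T : Set ℝ) :
    u c (twoAtom p q a b) '' ((fun r => (c * r)⁻¹) '' (T \ {0})) =
      uInv c p q a b '' (T \ {0}) := by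
  rw [image_image]
  exact image_congr fun r hr => u_twoAtom hc hp hq hr.2

theorem image_u_criticalPoints (hc : c ≠ 0) (hp : 0 < p) (hq : 0 < q) :
    u c (twoAtom p q a b) '' criticalPoints c (twoAtom p q a b) =
      uInv c p q a b '' (levelSet c p q a b \ {0}) := by
  rw [criticalPoints_twoAtom hc hp hq, image_u_twoAtom hc hp.le hq.le]

theorem image_u_criticalPoints_sdiff (hc : c ≠ 0) (hp : 0 < p) (hq : 0 < q) (ρ : ℝ) :
    u c (twoAtom p q a b) '' (criticalPoints c (twoAtom p q a b) \ {ρ⁻¹ / c}) =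
      uInv c p q a b '' ((levelSet c p q a b \ {ρ}) \ {0}) := by
  have hpoint : ({ρ⁻¹ / c} : Set ℝ) = (fun r => (c * r)⁻¹) '' {ρ} := by
    rw [image_singleton, mul_inv, div_eq_inv_mul]
  rw [criticalPoints_twoAtom hc hp hq, hpoint, ← image_sdiff (involutive_inv_mul hc).injective,
    sdiff_sdiff_comm, image_u_twoAtom hc hp.le hq.le]

theorem IsLSD.support_sdiff_zero {F : Measure ℝ} (hF : IsLSD c (twoAtom p q a b) F)
    (hc : 0 < c) (hp : 0 < p) (hq : 0 < q) :
    F.support \ {0} = (uInv c p q a b '' subcritical c p q a b)ᶜ \ {0} := by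
  have hcompl := hF.compl_support_eq hc
  rw [increasingPoints_twoAtom hc.ne' hp hq, image_u_twoAtom hc.ne' hp.le hq.le] at hcompl
  rw [← compl_compl F.support, hcompl]
  ext s
  simp only [Set.mem_sdiff, mem_compl_iff, mem_image, mem_singleton_iff]
  refine and_congr_left fun hs => not_congr (exists_congr fun r => ?_)
  rw [and_right_comm, and_iff_left_of_imp]
  rintro ⟨-, hr⟩ rfl
  exact hs (by simp [← hr, uInv])

end TwoAtom

end ScaleMixture

theorem mainTheorem10 (α₁ α₂ σ₁ σ₂ c : ℝ) (hα₁ : 0 < α₁) (hα₁' : α₁ < 1)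
    (hα : α₁ + α₂ = 1) (hσ₁ : 0 < σ₁) (hσ₂ : 0 < σ₂) (hσ : σ₁ ^ 2 ≠ σ₂ ^ 2) (hc : 0 < c)
    (G : Measure ℝ) (hG : G = ScaleMixture.twoAtom α₁ α₂ (σ₁ ^ 2) (σ₂ ^ 2)) :
    ∃ xstar : ℝ, (∀ x : ℝ, ScaleMixture.IsCriticalRoot G x ↔ x = xstar) ∧
      (ScaleMixture.criticalRatio G xstar < c →
        ∃ s₁ s₂ s₃ s₄ : ℝ, 0 ≤ s₁ ∧ s₁ < s₂ ∧ s₂ < s₃ ∧ s₃ < s₄ ∧ (s₁ = 0 ↔ c = 1) ∧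
          (c ≠ 1 → ScaleMixture.u c G '' ScaleMixture.criticalPoints c G = {s₁, s₂, s₃, s₄}) ∧
          (c = 1 → ScaleMixture.u c G '' ScaleMixture.criticalPoints c G = {s₂, s₃, s₄}) ∧
          ∀ F : Measure ℝ, ScaleMixture.IsLSD c G F →
            F.support \ {0} = (Set.Icc s₁ s₂ ∪ Set.Icc s₃ s₄) \ {0}) ∧
      (c ≤ ScaleMixture.criticalRatio G xstar →
        ∃ s₁ s₄ : ℝ, 0 ≤ s₁ ∧ s₁ < s₄ ∧ (s₁ = 0 ↔ c = 1) ∧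
          (c ≠ 1 → ScaleMixture.u c G '' (ScaleMixture.criticalPoints c G \ {xstar / c})
            = {s₁, s₄}) ∧
          (c = 1 → ScaleMixture.u c G '' (ScaleMixture.criticalPoints c G \ {xstar / c})
            = {s₄}) ∧
          ∀ F : Measure ℝ, ScaleMixture.IsLSD c G F →
            F.support \ {0} = Set.Icc s₁ s₄ \ {0}) := by
  have hα₂ : 0 < α₂ := by linarith
  subst hG
  wlog hlt : σ₁ ^ 2 < σ₂ ^ 2 generalizing α₁ α₂ σ₁ σ₂
  · rw [ScaleMixture.twoAtom_swap]
    exact this α₂ α₁ σ₂ σ₁ hα₂ (by linarith) (by linarith) hσ₂ hσ₁ hσ.symm hα₁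
      (hσ.lt_or_gt.resolve_left hlt)
  have ha : 0 < σ₁ ^ 2 := by positivity
  have hρ := ScaleMixture.middleRoot_neg hα₁ hα₂ ha (ha.trans hlt)
  refine ⟨_, fun x => ScaleMixture.isCriticalRoot_twoAtom_iff hα₁ hα₂ ha hlt, ?_, ?_⟩ <;>
    rw [ScaleMixture.criticalRatio_twoAtom_inv hα₁.le hα₂.le hρ.ne] <;> intro hmin
  · rw [ScaleMixture.image_u_criticalPoints hc.ne' hα₁ hα₂]
    obtain ⟨s₁, s₂, s₃, s₄, h₁, h₁₂, h₂₃, h₃₄, hzero, hne, heq, hsupp⟩ :=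
      ScaleMixture.exists_four_endpoints hc hα₁ hα₂ hα ha hlt hmin
    exact ⟨s₁, s₂, s₃, s₄, h₁, h₁₂, h₂₃, h₃₄, hzero, hne, heq, fun F hF => by
      rw [hF.support_sdiff_zero hc hα₁ hα₂, hsupp]⟩
  · rw [ScaleMixture.image_u_criticalPoints_sdiff hc.ne' hα₁ hα₂]
    obtain ⟨s₁, s₄, h₁, h₁₄, hzero, hne, heq, hsupp⟩ :=
      ScaleMixture.exists_two_endpoints hc hα₁ hα₂ hα ha hlt hmin
    exact ⟨s₁, s₄, h₁, h₁₄, hzero, hne, heq, fun F hF => by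
      rw [hF.support_sdiff_zero hc hα₁ hα₂, hsupp]⟩
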